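/- Let $S$ be a closed smooth surface. A multicurve in $S\times\mathbb{R}$ is a compact one-dimensional smooth embedded submanifold of $S\times\mathbb{R}$ (a finite, possibly empty, disjoint union of smoothly embedded circles) whose image under the projection $S\times\mathbb{R}\to S$ is also a one-dimensional smooth embedded submanifold, and no component of which bounds an embedded disc in $S\times\mathbb{R}$. A Morse function on a compact surface $H$ with boundary is a smooth function $\varphi:H\to\mathbb{R}$ such that the Hessian of $\varphi$ is nondegenerate at each point of $H$ at which $d\varphi=0$, and such that each critical point of $\varphi|_{\partial H}$ is a local extremum of $\varphi|_{\partial H}$ and is isolated among the critical points of $\varphi|_{\partial H}$. The critical points of $\varphi$ are the points of $H$ at which $d\varphi=0$, together with the points of $\partial H$ at which the derivative of $\varphi|_{\partial H}$ is zero. Lemma. Let $H$ be a compact surface smoothly embedded in $S\times\mathbb{R}$, whose boundary is the disjoint union of two multicurves $m_1$ and $m_2$. Then there is a smoothly embedded surface $H'$ in $S\times\mathbb{R}$ such that 1. $H'$ is homotopic to $H$: the inclusion of $H$ is smoothly homotopic, by a homotopy that may move the boundary, to a smooth embedding $H\to S\times\mathbb{R}$ with image $H'$; 2. the restriction $m_R$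 of the $\mathbb{R}$-coordinate to $H'$ is a Morse function; 3. no two distinct critical points of $m_R$ have the same value of the $\mathbb{R}$-coordinate. -/

import Mathlib

open scoped Manifold ContDiff Topology

section Multicurves

variable {S : Type*} [TopologicalSpace S] [ChartedSpace (EuclideanSpace ℝ (Fin 2)) S]

/-- The simple closed curve with image `c` bounds a disc in `S × ℝ`: it is the boundary of an
embedded closed disc. (A continuous injection of a compact disc is an embedding, the target
being Hausdorff.) -/
def BoundsDisc (c : Set (S × ℝ)) : Prop :=
  ∃ u : ℂ → S × ℝ, ContinuousOn u (Metric.closedBall 0 1) ∧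
    Set.InjOn u (Metric.closedBall 0 1) ∧ u '' Metric.sphere 0 1 = c

/-- A multicurve in `S × ℝ`: a compact one-dimensional smooth submanifold, that is, a finite
disjoint union of smoothly embedded circles, whose projection to `S` is again a compact
one-dimensional smooth submanifold, and no component of which bounds a disc. -/
def IsMulticurve (m : Set (S × ℝ)) : Prop :=
  (∃ (n : ℕ) (c : Fin n → Circle → S × ℝ),
    (∀ i, Manifold.IsSmoothEmbedding (𝓡 1) ((𝓡 2).prod 𝓘(ℝ, ℝ)) ∞ (c i)) ∧
    (∀ i j, i ≠ j → Disjoint (Set.range (c i)) (Set.range (c j))) ∧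
    (⋃ i, Set.range (c i)) = m ∧
    ∀ i, ¬ BoundsDisc (Set.range (c i))) ∧
  (∃ (k : ℕ) (d : Fin k → Circle → S),
    (∀ i, Manifold.IsSmoothEmbedding (𝓡 1) (𝓡 2) ∞ (d i)) ∧
    (∀ i j, i ≠ j → Disjoint (Set.range (d i)) (Set.range (d j))) ∧
    (⋃ i, Set.range (d i)) = Prod.fst '' m)

end Multicurves

section Homotopy

variable {S : Type*} [TopologicalSpace S] [ChartedSpace (EuclideanSpace ℝ (Fin 2)) S]
  {H : Type*} [TopologicalSpace H] [ChartedSpace (EuclideanHalfSpace 2) H]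

/-- Two maps from a surface with boundary `H` to `S × ℝ` are smoothly homotopic; the homotopy may
move the boundary of `H`. -/
def SmoothlyHomotopic (f g : H → S × ℝ) : Prop :=
  ∃ F : H × unitInterval → S × ℝ,
    ContMDiff ((𝓡∂ 2).prod (𝓡∂ 1)) ((𝓡 2).prod 𝓘(ℝ, ℝ)) ∞ F ∧
    (∀ x, F (x, 0) = f x) ∧ ∀ x, F (x, 1) = g x

end Homotopy

section Morse

variable {H : Type*} [TopologicalSpace H] [ChartedSpace (EuclideanHalfSpace 2) H]

/-- The function `φ` read in the preferred chart at `x`, a function on the half plane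
`{v | 0 ≤ v 0}`. -/
noncomputable def inChart (φ : H → ℝ) (x : H) : EuclideanSpace ℝ (Fin 2) → ℝ :=
  φ ∘ (extChartAt (𝓡∂ 2) x).symm

/-- The differential of `φ` at `x`, read in the preferred chart at `x`. (At boundary points this is
the full, two-dimensional differential.) -/
noncomputable def diffAt (φ : H → ℝ) (x : H) : EuclideanSpace ℝ (Fin 2) →L[ℝ] ℝ :=
  fderivWithin ℝ (inChart φ x) (Set.range (𝓡∂ 2)) (extChartAt (𝓡∂ 2) x x)

/-- The Hessian of `φ` at `x`, read in the preferred chart at `x`. -/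
noncomputable def hessAt (φ : H → ℝ) (x : H) :
    EuclideanSpace ℝ (Fin 2) →L[ℝ] EuclideanSpace ℝ (Fin 2) →L[ℝ] ℝ :=
  fderivWithin ℝ (fderivWithin ℝ (inChart φ x) (Set.range (𝓡∂ 2))) (Set.range (𝓡∂ 2))
    (extChartAt (𝓡∂ 2) x x)

/-- `x` is a boundary point at which the restriction of `φ` to the boundary has zero derivative.
The tangent vectors of the boundary are those with vanishing zeroth coordinate. -/
def IsBoundaryCritical (φ : H → ℝ) (x : H) : Prop :=
  x ∈ (𝓡∂ 2).boundary H ∧ ∀ v : EuclideanSpace ℝ (Fin 2), v 0 = 0 → diffAt φ x v = 0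

/-- The critical points of `φ` on a surface with boundary: the points with zero differential and
the critical points of the restriction to the boundary. -/
def IsCritical (φ : H → ℝ) (x : H) : Prop :=
  diffAt φ x = 0 ∨ IsBoundaryCritical φ x

/-- Morse functions on a surface with boundary: smooth functions such that the Hessian is
nondegenerate wherever the differential vanishes, and such that every critical point of the
restriction to the boundary is an isolated local extremum of this restriction. -/
structure IsMorse (φ : H → ℝ) : Prop where
  smooth : ContMDiff (𝓡∂ 2) 𝓘(ℝ, ℝ) ∞ φ
  nondegenerate : ∀ x, diffAt φ x = 0 → ∀ v, (∀ w, hessAt φ x v w = 0) → v = 0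
  boundary_extremum : ∀ x, IsBoundaryCritical φ x → IsLocalExtrOn φ ((𝓡∂ 2).boundary H) x
  boundary_isolated : ∀ x, IsBoundaryCritical φ x → ∀ᶠ y in 𝓝[≠] x, ¬ IsBoundaryCritical φ y

end Morse

/-! ### Null sets and a parametric Sard lemma -/

section NullSets

open MeasureTheory Filter Asymptotics

/-! Embed `S` in a Euclidean space by `e` and, for a linear functional `a`, shear `S × ℝ` by `(s, t)
↦ (s, a (e s) + t)`. This is a diffeomorphism homotopic to the identity, so it carries the embedding
`f` to a homotopic embedding, whose height function is `x ↦ a (e (f x).1) + (f x).2`. It remains to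
show that almost every `a` is good.

Nondegeneracy (`ae_injective_hess`): at a critical point a tangent vector killed by the differential
of the `E`-component is also killed by that of the `ℝ`-component, hence is zero as the surface is
immersed. So varying `a` moves the differential of the height in all directions, and the parametric
Sard lemma `addHaar_degenerate_eq_zero` makes the degenerate `a` a null set. The same applied to the
boundary curve gives a nonzero second derivative at boundary critical points, so these are isolated
extrema.

Distinct values (`ae_critical_values_ne`): nondegenerate critical values form countably many
branches `c a`, and by the envelope principle the derivative of `c` at `a` is evaluation at the
`E`-component of the critical point. Where two branches agree but these components differ, the
difference vanishes with nonzero derivative, which happens only on a null set. If the components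
agree, equal heights force equal points, as the shear and `f` are injective.

Derivatives are taken within arbitrary sets, so that half-plane charts need no extension across the
boundary. -/

lemma ContinuousLinearMap.det_eq_zero_of_apply_eq_zero {W : Type*} [NormedAddCommGroup W]
    [NormedSpace ℝ W] [FiniteDimensional ℝ W] (L : W →L[ℝ] W) {u : W} (hu : u ≠ 0)
    (h : L u = 0) : L.det = 0 := by
  by_contra hdet
  have hunit := LinearMap.isUnit_iff_isUnit_det (L : W →ₗ[ℝ] W) |>.2 (isUnit_iff_ne_zero.2 hdet)
  have hinj := (Module.End.isUnit_iff _).1 hunit |>.1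
  exact hu (hinj (by simpa using h))

variable {W : Type*} [NormedAddCommGroup W] [NormedSpace ℝ W] [FiniteDimensional ℝ W]
  [MeasurableSpace W] [BorelSpace W] (μ : Measure W) [μ.IsAddHaarMeasure]

/-- A set on which a function vanishes but has a nonzero derivative within the set is null. -/
lemma addHaar_eq_zero_of_hasFDerivWithinAt_ne_zero {s : Set W} {f : W → ℝ} {f' : W → W →L[ℝ] ℝ}
    (hf : ∀ a ∈ s, HasFDerivWithinAt f (f' a) s a) (hf' : ∀ a ∈ s, f' a ≠ 0)
    (hz : ∀ a ∈ s, f a = 0) : μ s = 0 := by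
  have hu : ∀ a, ∃ u : W, a ∈ s → f' a u ≠ 0 := by
    intro a
    by_cases ha : a ∈ s
    · obtain ⟨u, hu⟩ := DFunLike.ne_iff.1 (hf' a ha)
      exact ⟨u, fun _ => by simpa using hu⟩
    · exact ⟨0, fun h => (ha h).elim⟩
  choose u hu using hu
  -- Since `f` vanishes on `s`, the identity agrees there with `x ↦ x - f x • (f' a (u a))⁻¹ • u a`,
  -- whose derivative at `a` kills `u a`. So the identity has a singular derivative within `s`, and
  -- its image `s` is null.
  have key := addHaar_image_eq_zero_of_det_fderivWithin_eq_zero μ (s := s) (f := id)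
    (f' := fun a => ContinuousLinearMap.id ℝ W - (f' a).smulRight ((f' a (u a))⁻¹ • u a)) ?_ ?_
  · simpa using key
  · intro a ha
    have h1 := (hasFDerivWithinAt_id (𝕜 := ℝ) a s).fun_sub
      ((hf a ha).smul_const ((f' a (u a))⁻¹ • u a))
    exact h1.congr (fun x hx => by simp [hz x hx]) (by simp [hz a ha])
  · intro a ha
    refine ContinuousLinearMap.det_eq_zero_of_apply_eq_zero _ (u := u a) ?_ ?_
    · intro h0
      exact hu a ha (by simp [h0])
    · simp [smul_smul, hu a ha]

variable {V Y : Type*} [NormedAddCommGroup V] [NormedSpace ℝ V] [FiniteDimensional ℝ V]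
  [NormedAddCommGroup Y] [NormedSpace ℝ Y] [FiniteDimensional ℝ Y]

/-- Parametric Sard lemma for maps that are affine in the parameter, local version. -/
lemma exists_nhdsWithin_addHaar_degenerate_eq_zero
    (hd : Module.finrank ℝ V = Module.finrank ℝ Y) {Ω : Set V}
    {α : V → Y} {B : V → W →L[ℝ] Y} {α' : V → V →L[ℝ] Y} {B' : V → V →L[ℝ] W →L[ℝ] Y}
    (hα : ∀ v ∈ Ω, HasFDerivWithinAt α (α' v) Ω v)
    (hB : ∀ v ∈ Ω, HasFDerivWithinAt B (B' v) Ω v)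
    {v₀ : V} (hv₀ : v₀ ∈ Ω) (hsurj : Function.Surjective (B v₀)) :
    ∃ U ∈ 𝓝[Ω] v₀, μ {a | ∃ v ∈ U, v ∈ Ω ∧ α v + B v a = 0 ∧
      ∃ w ≠ 0, α' v w + B' v w a = 0} = 0 := by
  obtain ⟨R, hR⟩ := ContinuousLinearMap.exists_rightInverse_of_surjective (B v₀)
    (LinearMap.range_eq_top.2 hsurj)
  have hR' : ∀ y, B v₀ (R y) = y := fun y => by simpa using congrArg (fun L => L y) hR
  -- An arbitrary identification: it lets one vector `b : W` encode both a point `v`, through `B v₀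
  -- b = T v`, and a component in the kernel of `B v₀`.
  let T : V ≃L[ℝ] Y := ContinuousLinearEquiv.ofFinrankEq hd
  let C : V → Y →L[ℝ] Y := fun v => (B v).comp R
  have hC : ∀ v ∈ Ω, DifferentiableWithinAt ℝ C Ω v := fun v hv =>
    (hB v hv).differentiableWithinAt.clm_comp (differentiableWithinAt_const R)
  have hC0 : IsUnit (C v₀) := by
    have : C v₀ = 1 := hR
    rw [this]; exact isUnit_one
  let U : Set V := {v | IsUnit (C v)}
  have hU : U ∈ 𝓝[Ω] v₀ := (hC v₀ hv₀).continuousWithinAt (Units.isOpen.mem_nhds hC0)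
  refine ⟨U, hU, ?_⟩
  let x : W → V := fun b => T.symm (B v₀ b)
  let M : V → Y →L[ℝ] Y := fun v => Ring.inverse (C v)
  have hM : ∀ v ∈ Ω, v ∈ U → DifferentiableWithinAt ℝ M Ω v := fun v hv hvU =>
    (differentiableAt_inverse hvU).comp_differentiableWithinAt v (hC v hv)
  have hMC : ∀ v ∈ U, ∀ y, M v (B v (R y)) = y := fun v hv y => by
    have := congrArg (fun L : Y →L[ℝ] Y => L y) (Ring.inverse_mul_cancel (C v) hv)
    simpa [C] using this
  have hCM : ∀ v ∈ U, ∀ y, B v (R (M v y)) = y := fun v hv y => by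
    have := congrArg (fun L : Y →L[ℝ] Y => L y) (Ring.mul_inverse_cancel (C v) hv)
    simpa [C] using this
  -- `Ξ b` corrects `b` along the range of `R` until it solves the equation at `x b`. Thus `Ξ`
  -- parametrizes the solutions `a` near `v₀`, and degenerate solutions are images of points where
  -- its derivative is singular.
  let Ξ : W → W := fun b => b - R (M (x b) (α (x b) + B (x b) b))
  have hΞ : ∀ b, x b ∈ U → α (x b) + B (x b) (Ξ b) = 0 := fun b hb => by
    simp only [Ξ, map_sub, hCM _ hb]
    abel
  let D : V → W → V →L[ℝ] Y := fun v a => α' v + (B' v).flip a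
  let s : Set W := {b | x b ∈ U ∧ x b ∈ Ω ∧ ∃ w ≠ 0, D (x b) (Ξ b) w = 0}
  let Ξ' : W → W →L[ℝ] W := fun b =>
    ContinuousLinearMap.id ℝ W - (R.comp (M (x b))).comp
      ((D (x b) (Ξ b)).comp ((T.symm : Y →L[ℝ] V).comp (B v₀)) + B (x b))
  have himage : {a | ∃ v ∈ U, v ∈ Ω ∧ α v + B v a = 0 ∧
      ∃ w ≠ 0, α' v w + B' v w a = 0} ⊆ Ξ '' s := by
    rintro a ⟨v, hvU, hvΩ, h0, w, hw, hdeg⟩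
    let b : W := a - R (B v₀ a - T v)
    have hxb : x b = v := by simp [x, b, hR']
    have hba : Ξ b = a := by
      have h1 : α v + B v b = - B v (R (B v₀ a - T v)) := by
        simp only [b, map_sub]
        rw [← add_sub_assoc, h0, zero_sub]
      simp only [Ξ, hxb]
      rw [h1, map_neg, hMC v hvU]
      simp only [b, sub_sub, neg_sub, map_sub]
      abel
    refine ⟨b, ⟨by rwa [hxb], by rwa [hxb], w, hw, ?_⟩, hba⟩
    rw [hxb, hba]
    simpa [D] using hdeg
  refine measure_mono_null himage
    (addHaar_image_eq_zero_of_det_fderivWithin_eq_zero μ (f' := Ξ') ?_ ?_)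
  · rintro b ⟨hbU, hbΩ, -⟩
    set a := Ξ b with ha
    have hx : HasFDerivWithinAt x ((T.symm : Y →L[ℝ] V).comp (B v₀)) s b :=
      ((T.symm : Y →L[ℝ] V).comp (B v₀)).hasFDerivWithinAt
    have hmaps : Set.MapsTo x s Ω := fun b' hb' => hb'.2.1
    -- Up to a constant, `Ξ b'` is `b' - R (M (x b') (k b'))`, where `k` is the function
    -- differentiated here. As `k b = 0`, the unknown derivative of `M` drops out.
    have hk : HasFDerivWithinAt (fun b' => α (x b') + B (x b') a + B (x b') (b' - b))
        ((D (x b) a).comp ((T.symm : Y →L[ℝ] V).comp (B v₀)) + B (x b)) s b := by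
      have hα1 := (hα _ hbΩ).comp b hx hmaps
      have hB1 := (hB _ hbΩ).comp b hx hmaps
      have h1 := hB1.clm_apply (hasFDerivWithinAt_const a b s)
      have h2 := hB1.clm_apply ((hasFDerivWithinAt_id (𝕜 := ℝ) b s).sub_const b)
      refine ((hα1.add h1).add h2).congr_fderiv ?_
      ext β
      simp [D]
    obtain ⟨M', hM'⟩ : ∃ M', HasFDerivWithinAt (fun b' => M (x b')) M' s b :=
      ⟨_, (((hM _ hbΩ hbU).hasFDerivWithinAt).comp b hx hmaps)⟩
    have h3 := hM'.clm_apply hk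
    have h4 := R.hasFDerivAt.comp_hasFDerivWithinAt b h3
    have h5 := ((hasFDerivWithinAt_id (𝕜 := ℝ) b s).fun_sub h4).sub_const
      (R (M (x b) (α (x b) + B (x b) b)))
    have hk0 : α (x b) + B (x b) a + B (x b) (b - b) = 0 := by simp [ha, hΞ b hbU]
    rw [hk0] at h5
    refine (h5.congr_fderiv ?_).congr (fun b' hb' => ?_) ?_
    · ext β
      simp [Ξ', ha]
    · simp only [Ξ, ha, map_add, map_sub, hMC _ hb'.1, id, Function.comp_apply]
      abel
    · simp only [Ξ, ha, map_add, map_sub, hMC _ hbU, id, Function.comp_apply]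
      abel
  · rintro b ⟨hbU, hbΩ, w, hw, hdeg⟩
    -- Moving `b` by `R (T w)` moves `x b` by `w`; as `w` is degenerate, `M` returns exactly `T w`,
    -- and the correction cancels the movement.
    refine ContinuousLinearMap.det_eq_zero_of_apply_eq_zero _ (u := R (T w)) ?_ ?_
    · intro h0
      have : T w = 0 := by rw [← hR' (T w), h0, map_zero]
      exact hw (by simpa using this)
    · simp [Ξ', hR', hdeg, hMC _ hbU]

/-- Parametric Sard lemma for maps that are affine in the parameter. -/
lemma addHaar_degenerate_eq_zero
    (hd : Module.finrank ℝ V = Module.finrank ℝ Y) {Ω : Set V}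
    {α : V → Y} {B : V → W →L[ℝ] Y} {α' : V → V →L[ℝ] Y} {B' : V → V →L[ℝ] W →L[ℝ] Y}
    (hα : ∀ v ∈ Ω, HasFDerivWithinAt α (α' v) Ω v)
    (hB : ∀ v ∈ Ω, HasFDerivWithinAt B (B' v) Ω v) :
    μ {a | ∃ v ∈ Ω, Function.Surjective (B v) ∧ α v + B v a = 0 ∧
      ∃ w ≠ 0, α' v w + B' v w a = 0} = 0 := by
  have hloc : ∀ v, ∃ U : Set V, v ∈ Ω → Function.Surjective (B v) → U ∈ 𝓝[Ω] v ∧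
      μ {a | ∃ v ∈ U, v ∈ Ω ∧ α v + B v a = 0 ∧ ∃ w ≠ 0, α' v w + B' v w a = 0} = 0 := by
    intro v
    by_cases h : v ∈ Ω ∧ Function.Surjective (B v)
    · obtain ⟨U, hU⟩ := exists_nhdsWithin_addHaar_degenerate_eq_zero μ hd hα hB h.1 h.2
      exact ⟨U, fun _ _ => hU⟩
    · exact ⟨∅, fun h1 h2 => (h ⟨h1, h2⟩).elim⟩
  choose U hU using hloc
  let D : Set V := {v ∈ Ω | Function.Surjective (B v)}
  obtain ⟨t, htD, htc, hcover⟩ := TopologicalSpace.countable_cover_nhdsWithin (s := D) (f := U)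
    fun v hv => nhdsWithin_mono v (Set.sep_subset _ _) (hU v hv.1 hv.2).1
  refine measure_mono_null ?_ ((measure_biUnion_null_iff htc).2
    fun v hv => (hU v (htD hv).1 (htD hv).2).2)
  rintro a ⟨v, hv, hs, h⟩
  obtain ⟨v₁, hv₁, hmem⟩ := Set.mem_iUnion₂.1 (hcover (show v ∈ D from ⟨hv, hs⟩))
  exact Set.mem_iUnion₂.2 ⟨v₁, hv₁, v, hmem, hv, h⟩

end NullSets

/-! ### Immersed patches and generic nondegeneracy -/

section Patches

open MeasureTheory Filter Asymptotics

/-- A twice differentiable injectively differentiable map on a subset of a normed space. -/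
structure ImmersedPatch (V F : Type*) [NormedAddCommGroup V] [NormedSpace ℝ V]
    [NormedAddCommGroup F] [NormedSpace ℝ F] where
  dom : Set V
  map : V → F
  d1 : V → V →L[ℝ] F
  d2 : V → V →L[ℝ] V →L[ℝ] F
  hasD1 : ∀ v ∈ dom, HasFDerivWithinAt map (d1 v) dom v
  hasD2 : ∀ v ∈ dom, HasFDerivWithinAt d1 (d2 v) dom v
  inj : ∀ v ∈ dom, Function.Injective (d1 v)

variable {V E : Type*} [NormedAddCommGroup V] [NormedSpace ℝ V] [NormedAddCommGroup E]
  [NormedSpace ℝ E]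

/-- The functional `(y, t) ↦ a y + t`. -/
noncomputable def affineHeight (a : E →L[ℝ] ℝ) : E × ℝ →L[ℝ] ℝ :=
  a.coprod (ContinuousLinearMap.id ℝ ℝ)

@[simp]
lemma affineHeight_apply (a : E →L[ℝ] ℝ) (z : E × ℝ) : affineHeight a z = a z.1 + z.2 := by
  simp [affineHeight]

namespace ImmersedPatch

/-- `v` is a critical point of the function `v ↦ a (p.map v).1 + (p.map v).2`. -/
def IsCrit (p : ImmersedPatch V (E × ℝ)) (a : E →L[ℝ] ℝ) (v : V) : Prop :=
  v ∈ p.dom ∧ (affineHeight a).comp (p.d1 v) = 0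

/-- The Hessian of `v ↦ a (p.map v).1 + (p.map v).2` at `v`. -/
noncomputable def hess (p : ImmersedPatch V (E × ℝ)) (a : E →L[ℝ] ℝ) (v : V) :
    V →L[ℝ] V →L[ℝ] ℝ :=
  (ContinuousLinearMap.compL ℝ V (E × ℝ) ℝ (affineHeight a)).comp (p.d2 v)

@[simp]
lemma hess_apply (p : ImmersedPatch V (E × ℝ)) (a : E →L[ℝ] ℝ) (v w w' : V) :
    p.hess a v w w' = affineHeight a (p.d2 v w w') := by
  simp [hess]

variable [FiniteDimensional ℝ V] [FiniteDimensional ℝ E]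
  [MeasurableSpace (E →L[ℝ] ℝ)] [BorelSpace (E →L[ℝ] ℝ)]
  (μ : Measure (E →L[ℝ] ℝ)) [μ.IsAddHaarMeasure]

set_option maxSynthPendingDepth 3 in
/-- For almost every functional, all critical points are nondegenerate. -/
theorem ae_injective_hess (p : ImmersedPatch V (E × ℝ)) :
    ∀ᵐ a ∂μ, ∀ v, p.IsCrit a v → ∀ w, p.hess a v w = 0 → w = 0 := by
  let fstL : (V →L[ℝ] E × ℝ) →L[ℝ] V →L[ℝ] E :=
    ContinuousLinearMap.compL ℝ V (E × ℝ) E (ContinuousLinearMap.fst ℝ E ℝ)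
  let sndL : (V →L[ℝ] E × ℝ) →L[ℝ] V →L[ℝ] ℝ :=
    ContinuousLinearMap.compL ℝ V (E × ℝ) ℝ (ContinuousLinearMap.snd ℝ E ℝ)
  let BL : (V →L[ℝ] E × ℝ) →L[ℝ] (E →L[ℝ] ℝ) →L[ℝ] V →L[ℝ] ℝ :=
    (ContinuousLinearMap.compL ℝ V E ℝ).flip.comp fstL
  have hd : Module.finrank ℝ V = Module.finrank ℝ (V →L[ℝ] ℝ) := by
    rw [← (LinearMap.toContinuousLinearMap (𝕜 := ℝ) (E := V) (F' := ℝ)).finrank_eq]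
    exact (Subspace.dual_finrank_eq (K := ℝ) (V := V)).symm
  have hα : ∀ v ∈ p.dom, HasFDerivWithinAt (fun v => sndL (p.d1 v)) (sndL.comp (p.d2 v)) p.dom v :=
    fun v hv => sndL.hasFDerivAt.comp_hasFDerivWithinAt v (p.hasD2 v hv)
  have hB : ∀ v ∈ p.dom, HasFDerivWithinAt (fun v => BL (p.d1 v)) (BL.comp (p.d2 v)) p.dom v :=
    fun v hv => BL.hasFDerivAt.comp_hasFDerivWithinAt v (p.hasD2 v hv)
  refine measure_mono_null ?_ (addHaar_degenerate_eq_zero μ hd hα hB)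
  intro a ha
  simp only [Set.mem_compl_iff, Set.mem_ofPred_eq, not_forall] at ha
  obtain ⟨v, ⟨hv, hcrit⟩, w, hw, hw0⟩ := ha
  have hcrit' : ∀ u, a (p.d1 v u).1 + (p.d1 v u).2 = 0 := fun u => by
    simpa using congrArg (fun L => L u) hcrit
  refine ⟨v, hv, ?_, ?_, w, hw0, ?_⟩
  -- The fixed coefficient `1` of the last coordinate is used here: at a critical point the
  -- `E`-component alone is immersive, so every functional on `V` factors through it.
  · have hinj : Function.Injective (fstL (p.d1 v)) := by
      rw [injective_iff_map_eq_zero]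
      intro u hu
      have h1 : (p.d1 v u).1 = 0 := by simpa [fstL] using hu
      have h2 : (p.d1 v u).2 = 0 := by simpa [h1] using hcrit' u
      exact p.inj v hv (by rw [map_zero]; exact Prod.ext h1 h2)
    obtain ⟨G, hG⟩ := ((fstL (p.d1 v) : V →L[ℝ] E) : V →ₗ[ℝ] E).exists_leftInverse_of_injective
      (LinearMap.ker_eq_bot.2 hinj)
    intro ℓ
    refine ⟨ℓ.comp (LinearMap.toContinuousLinearMap G), ?_⟩
    ext u
    have hGu : G (fstL (p.d1 v) u) = u := by simpa using congrArg (fun L => L u) hG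
    simpa [BL] using congrArg ℓ hGu
  · ext u
    simpa [sndL, BL, fstL, add_comm] using hcrit' u
  · ext u
    simpa [sndL, BL, fstL, add_comm] using congrArg (fun L => L u) hw

end ImmersedPatch

end Patches

/-! ### Branches of critical values -/

section Branches

open MeasureTheory Filter Asymptotics

namespace ImmersedPatch

variable {V E : Type*} [NormedAddCommGroup V] [NormedSpace ℝ V] [NormedAddCommGroup E]
  [NormedSpace ℝ E]

lemma affineHeight_sub_norm_le {F : Type*} [NormedAddCommGroup F] [NormedSpace ℝ F]
    (a a' : E →L[ℝ] ℝ) (D : F →L[ℝ] E × ℝ) :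
    ‖(affineHeight a).comp D - (affineHeight a').comp D‖ ≤ ‖a - a'‖ * ‖D‖ := by
  refine ContinuousLinearMap.opNorm_le_bound _ (by positivity) fun w => ?_
  have h1 : ((affineHeight a).comp D - (affineHeight a').comp D) w = (a - a') (D w).1 := by
    simp
  rw [h1, mul_assoc]
  refine ((a - a').le_opNorm _).trans (mul_le_mul_of_nonneg_left ?_ (norm_nonneg _))
  exact (norm_fst_le _).trans (D.le_opNorm w)

lemma hasFDerivWithinAt_affineHeight_comp_d1 (p : ImmersedPatch V (E × ℝ)) (a : E →L[ℝ] ℝ)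
    {v : V} (hv : v ∈ p.dom) :
    HasFDerivWithinAt (fun v => (affineHeight a).comp (p.d1 v)) (p.hess a v) p.dom v :=
  (ContinuousLinearMap.compL ℝ V (E × ℝ) ℝ (affineHeight a)).hasFDerivAt.comp_hasFDerivWithinAt v
    (p.hasD2 v hv)

/-- A critical value depending on the functional through a Lipschitz choice of critical points is
differentiable. -/
lemma hasFDerivWithinAt_critical_value (p : ImmersedPatch V (E × ℝ)) {s : Set (E →L[ℝ] ℝ)}
    {x : (E →L[ℝ] ℝ) → V} {a : E →L[ℝ] ℝ} (ha : a ∈ s) (hx : ∀ a ∈ s, p.IsCrit a (x a)) {k : ℝ}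
    (hk : ∀ a' ∈ s, ‖x a' - x a‖ ≤ k * ‖a' - a‖) :
    HasFDerivWithinAt (fun a => affineHeight a (p.map (x a)))
      (ContinuousLinearMap.apply ℝ ℝ (p.map (x a)).1) s a := by
  have hO : (fun a' => x a' - x a) =O[𝓝[s] a] fun a' => a' - a :=
    IsBigO.of_bound k (eventually_mem_nhdsWithin.mono fun a' ha' => hk a' ha')
  have hsub : Tendsto (fun a' => a' - a) (𝓝[s] a) (𝓝 0) := by
    have : ContinuousWithinAt (fun a' => a' - a) s a := by fun_prop
    simpa using this.tendsto
  have hcont : Tendsto x (𝓝[s] a) (𝓝[p.dom] (x a)) :=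
    tendsto_nhdsWithin_iff.2 ⟨tendsto_sub_nhds_zero_iff.1 (hO.trans_tendsto hsub),
      eventually_mem_nhdsWithin.mono fun a' ha' => (hx a' ha').1⟩
  have hJ := p.hasD1 _ (hx a ha).1
  -- Envelope principle: for fixed `a`, moving the critical point changes the value to higher order
  -- only. The mixed term `h2` is small by continuity, which leaves `(a' - a)` evaluated at the old
  -- point.
  have h1 : (fun a' => affineHeight a (p.map (x a')) - affineHeight a (p.map (x a)))
      =o[𝓝[s] a] fun a' => a' - a := by
    have h := ((affineHeight a).hasFDerivAt.comp_hasFDerivWithinAt _ hJ)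
    rw [(hx a ha).2] at h
    have h' := (h.isLittleO.comp_tendsto hcont).trans_isBigO hO
    simpa [Function.comp_def] using h'
  have h2 : (fun a' => (a' - a) ((p.map (x a')).1 - (p.map (x a)).1))
      =o[𝓝[s] a] fun a' => a' - a := by
    have h0 : Tendsto (fun a' => (p.map (x a')).1 - (p.map (x a)).1) (𝓝[s] a) (𝓝 0) :=
      tendsto_sub_nhds_zero_iff.2
        ((continuous_fst.tendsto _).comp (hJ.continuousWithinAt.tendsto.comp hcont))
    have h3 : (fun a' => ‖a' - a‖ * ‖(p.map (x a')).1 - (p.map (x a)).1‖)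
        =o[𝓝[s] a] fun a' => ‖a' - a‖ * (1 : ℝ) :=
      (isBigO_refl _ _).mul_isLittleO ((isLittleO_one_iff ℝ).2 (by simpa using h0.norm))
    simp only [mul_one] at h3
    refine (IsBigO.of_bound 1 (Eventually.of_forall fun a' => ?_)).trans_isLittleO h3.of_norm_right
    rw [one_mul, norm_mul, norm_norm, norm_norm]
    exact (a' - a).le_opNorm _
  refine HasFDerivWithinAt.of_isLittleO ((h1.add h2).congr_left fun a' => ?_)
  simp
  ring

variable [FiniteDimensional ℝ V]

/-- Critical points near a nondegenerate one depend on the functional in a Lipschitz way. -/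
lemma exists_lipschitz_of_nondegenerate (p : ImmersedPatch V (E × ℝ)) {a : E →L[ℝ] ℝ} {v : V}
    (hc : p.IsCrit a v) (hn : ∀ w, p.hess a v w = 0 → w = 0) :
    ∃ k : ℕ, ∀ a' v', p.IsCrit a' v' → dist (a', v') (a, v) < 1 / ((k : ℝ) + 1) →
      ‖v' - v‖ ≤ k * ‖a' - a‖ := by
  obtain ⟨K, hK, hanti⟩ := (p.hess a v : V →ₗ[ℝ] V →L[ℝ] ℝ).exists_antilipschitzWith
    (LinearMap.ker_eq_bot'.2 hn)
  have hK' : (0 : ℝ) < K := hK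
  have hle : ∀ w, ‖w‖ ≤ K * ‖p.hess a v w‖ := fun w => by
    simpa using hanti.le_mul_norm_sub w 0
  -- With error constant `1 / (2 * K)`, the remainder contributes at most `‖v' - v‖ / 2`, which is
  -- absorbed on the left in `h7`.
  have h1 := (p.hasFDerivWithinAt_affineHeight_comp_d1 a hc.1).isLittleO.def
    (show (0 : ℝ) < 1 / (2 * K) by positivity)
  have h2 : ∀ᶠ v' in 𝓝[p.dom] v, ‖p.d1 v'‖ < ‖p.d1 v‖ + 1 :=
    (p.hasD2 v hc.1).continuousWithinAt.norm.eventually_lt_const (lt_add_one _)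
  obtain ⟨ε, hε, hball⟩ := Metric.mem_nhdsWithin_iff.1 (h1.and h2)
  set C : ℝ := 2 * K * (‖p.d1 v‖ + 1)
  obtain ⟨k₁, hk₁⟩ := exists_nat_one_div_lt hε
  obtain ⟨k₂, hk₂⟩ := exists_nat_ge C
  -- One integer serves both as the inverse radius and as the Lipschitz constant, so that countably
  -- many cases suffice.
  refine ⟨max k₁ k₂, fun a' v' hc' hdist => ?_⟩
  have hk : (k₁ : ℝ) ≤ (max k₁ k₂ : ℕ) := by exact_mod_cast le_max_left _ _
  have hk' : (k₂ : ℝ) ≤ (max k₁ k₂ : ℕ) := by exact_mod_cast le_max_right _ _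
  have hv' : v' ∈ Metric.ball v ε := by
    have : dist v' v ≤ dist (a', v') (a, v) := by
      rw [Prod.dist_eq]; exact le_max_right _ _
    refine (this.trans_lt hdist).trans (lt_of_le_of_lt ?_ hk₁)
    exact one_div_le_one_div_of_le (by positivity) (by linarith)
  obtain ⟨h3, h4⟩ := hball ⟨hv', hc'.1⟩
  rw [hc.2, sub_zero] at h3
  have h5 : ‖(affineHeight a).comp (p.d1 v')‖ ≤ ‖a' - a‖ * (‖p.d1 v‖ + 1) := by
    have := affineHeight_sub_norm_le a a' (p.d1 v')
    rw [hc'.2, sub_zero, norm_sub_rev] at this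
    exact this.trans (mul_le_mul_of_nonneg_left h4.le (norm_nonneg _))
  have h6 : ‖p.hess a v (v' - v)‖ ≤ ‖a' - a‖ * (‖p.d1 v‖ + 1) + 1 / (2 * K) * ‖v' - v‖ := by
    have := norm_sub_le ((affineHeight a).comp (p.d1 v'))
      ((affineHeight a).comp (p.d1 v') - p.hess a v (v' - v))
    rw [sub_sub_cancel] at this
    linarith
  have h7 : ‖v' - v‖ ≤ K * (‖a' - a‖ * (‖p.d1 v‖ + 1)) + ‖v' - v‖ / 2 := by
    refine (hle _).trans ((mul_le_mul_of_nonneg_left h6 hK'.le).trans (le_of_eq ?_))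
    field_simp
  have h8 : ‖v' - v‖ ≤ C * ‖a' - a‖ := by
    simp only [C]
    linarith
  exact h8.trans (mul_le_mul_of_nonneg_right (hk₂.trans hk') (norm_nonneg _))

/-- The critical values of nondegenerate critical points form countably many differentiable
branches. -/
lemma exists_countable_branches [FiniteDimensional ℝ E] (p : ImmersedPatch V (E × ℝ)) :
    ∃ (s : ℕ × ℕ → Set (E →L[ℝ] ℝ)) (c : ℕ × ℕ → (E →L[ℝ] ℝ) → ℝ)
      (y : ℕ × ℕ → (E →L[ℝ] ℝ) → E),
      (∀ j, ∀ a ∈ s j, HasFDerivWithinAt (c j) (ContinuousLinearMap.apply ℝ ℝ (y j a)) (s j) a) ∧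
      ∀ a v, p.IsCrit a v → (∀ w, p.hess a v w = 0 → w = 0) →
        ∃ j, a ∈ s j ∧ c j a = affineHeight a (p.map v) ∧ y j a = (p.map v).1 := by
  let d : ℕ → (E →L[ℝ] ℝ) × V := TopologicalSpace.denseSeq _
  -- Points with Lipschitz constant and inverse radius governed by `j.1`, near the dense point `d
  -- j.2`. The halved radius puts any two points of a piece within the range of each other's
  -- estimate, so each piece is the graph of a Lipschitz function of `a`.
  let Z : ℕ × ℕ → Set ((E →L[ℝ] ℝ) × V) := fun j => {z | p.IsCrit z.1 z.2 ∧
    (∀ a' v', p.IsCrit a' v' → dist (a', v') z < 1 / ((j.1 : ℝ) + 1) →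
      ‖v' - z.2‖ ≤ j.1 * ‖a' - z.1‖) ∧ dist z (d j.2) < 1 / (2 * ((j.1 : ℝ) + 1))}
  have hex : ∀ j a, ∃ v, a ∈ Prod.fst '' Z j → (a, v) ∈ Z j := by
    intro j a
    by_cases h : a ∈ Prod.fst '' Z j
    · obtain ⟨z, hz, rfl⟩ := h
      exact ⟨z.2, fun _ => hz⟩
    · exact ⟨0, fun h' => (h h').elim⟩
  choose x hx using hex
  have hlip : ∀ j, ∀ z ∈ Z j, ∀ z' ∈ Z j, ‖z'.2 - z.2‖ ≤ j.1 * ‖z'.1 - z.1‖ := by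
    intro j z hz z' hz'
    refine hz.2.1 z'.1 z'.2 hz'.1 ?_
    have h1 := dist_triangle_right z' z (d j.2)
    have h2 := hz.2.2
    have h3 := hz'.2.2
    have h4 : 1 / ((j.1 : ℝ) + 1) = 1 / (2 * ((j.1 : ℝ) + 1)) + 1 / (2 * ((j.1 : ℝ) + 1)) := by
      field_simp
      norm_num
    rw [h4]
    exact h1.trans_lt (add_lt_add h3 h2)
  refine ⟨fun j => Prod.fst '' Z j, fun j a => affineHeight a (p.map (x j a)),
    fun j a => (p.map (x j a)).1, fun j a ha => ?_, fun a v hc hn => ?_⟩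
  · exact p.hasFDerivWithinAt_critical_value ha (fun a' ha' => (hx j a' ha').1)
      fun a' ha' => hlip j _ (hx j a ha) _ (hx j a' ha')
  · obtain ⟨k, hk⟩ := p.exists_lipschitz_of_nondegenerate hc hn
    obtain ⟨i, hi⟩ := (TopologicalSpace.denseRange_denseSeq ((E →L[ℝ] ℝ) × V)).exists_dist_lt (a, v)
      (show (0 : ℝ) < 1 / (2 * ((k : ℝ) + 1)) by positivity)
    have hz : (a, v) ∈ Z (k, i) := ⟨hc, hk, hi⟩
    have ha : a ∈ Prod.fst '' Z (k, i) := ⟨_, hz, rfl⟩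
    -- The Lipschitz bound over a single `a` leaves only one critical point in the piece.
    have hxv : x (k, i) a = v := by
      have := hlip _ _ hz _ (hx _ a ha)
      simpa [sub_eq_zero] using this
    exact ⟨(k, i), ha, by simp only [hxv], by simp only [hxv]⟩

/-- For almost every functional, nondegenerate critical points with different first components
have different values. -/
theorem ae_critical_values_ne [FiniteDimensional ℝ E] {V' : Type*} [NormedAddCommGroup V']
    [NormedSpace ℝ V'] [FiniteDimensional ℝ V']
    [MeasurableSpace (E →L[ℝ] ℝ)] [BorelSpace (E →L[ℝ] ℝ)]
    (μ : Measure (E →L[ℝ] ℝ)) [μ.IsAddHaarMeasure]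
    (p : ImmersedPatch V (E × ℝ)) (q : ImmersedPatch V' (E × ℝ)) :
    ∀ᵐ a ∂μ, ∀ v w, p.IsCrit a v → q.IsCrit a w → (p.map v).1 ≠ (q.map w).1 →
      affineHeight a (p.map v) ≠ affineHeight a (q.map w) := by
  obtain ⟨s, c, y, hs, hp⟩ := p.exists_countable_branches
  obtain ⟨s', c', y', hs', hq⟩ := q.exists_countable_branches
  have hnull : ∀ i j, ∀ᵐ a ∂μ, ¬ (a ∈ s i ∧ a ∈ s' j ∧ c i a = c' j a ∧ y i a ≠ y' j a) := by
    intro i j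
    rw [ae_iff]
    simp only [not_not]
    -- The derivative of the difference is evaluation at `y i a` minus evaluation at `y' j a`,
    -- nonzero because functionals separate points.
    refine addHaar_eq_zero_of_hasFDerivWithinAt_ne_zero μ (f := fun a => c i a - c' j a)
      (f' := fun a => ContinuousLinearMap.apply ℝ ℝ (y i a) -
        ContinuousLinearMap.apply ℝ ℝ (y' j a)) ?_ ?_ ?_
    · rintro a ⟨ha, ha', -⟩
      exact ((hs i a ha).mono fun b hb => hb.1).fun_sub ((hs' j a ha').mono fun b hb => hb.2.1)
    · rintro a ⟨-, -, -, hne⟩ h0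
      obtain ⟨g, hg⟩ := SeparatingDual.exists_separating_of_ne (R := ℝ) hne
      have := congrArg (fun L => L g) h0
      simp only [sub_apply, ContinuousLinearMap.apply_apply, zero_apply,
        sub_eq_zero] at this
      exact hg this
    · rintro a ⟨-, -, h, -⟩
      exact sub_eq_zero.2 h
  filter_upwards [p.ae_injective_hess μ, q.ae_injective_hess μ,
    ae_all_iff.2 fun i => ae_all_iff.2 fun j => hnull i j] with a h1 h2 h3 v w hv hw hne heq
  obtain ⟨i, hi, hci, hyi⟩ := hp a v hv (h1 v hv)
  obtain ⟨j, hj, hcj, hyj⟩ := hq a w hw (h2 w hw)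
  exact h3 i j ⟨hi, hj, by rw [hci, hcj, heq], by rwa [hyi, hyj]⟩

end ImmersedPatch

end Branches

/-! ### Smooth embeddings, diffeomorphisms and injective differentials -/

section Immersions

open Set Filter Function

variable {E E' : Type*} [NormedAddCommGroup E] [NormedSpace ℝ E]
  [NormedAddCommGroup E'] [NormedSpace ℝ E']
  {H G : Type*} [TopologicalSpace H] [TopologicalSpace G]
  {I : ModelWithCorners ℝ E H} {J : ModelWithCorners ℝ E' G}
  {M N : Type*} [TopologicalSpace M] [ChartedSpace H M] [TopologicalSpace N] [ChartedSpace G N]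
  {n : ℕ∞ω}

lemma IsManifold.trans_diffeomorph_mem_maximalAtlas [IsManifold J n N]
    {ψ : OpenPartialHomeomorph N G} (hψ : ψ ∈ IsManifold.maximalAtlas J n N)
    (Ψ : Diffeomorph J J N N n) :
    Ψ.toHomeomorph.transOpenPartialHomeomorph ψ ∈ IsManifold.maximalAtlas J n N := by
  refine OpenPartialHomeomorph.mem_maximalAtlas_of_contMDiffOn _ ?_ ?_
  · exact (contMDiffOn_of_mem_maximalAtlas hψ).comp Ψ.contMDiff.contMDiffOn fun x hx => hx
  · exact Ψ.symm.contMDiff.comp_contMDiffOn (contMDiffOn_symm_of_mem_maximalAtlas hψ)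

/-- Composing a smooth embedding with a diffeomorphism gives a smooth embedding. -/
lemma Manifold.IsSmoothEmbedding.diffeomorph_comp [IsManifold J n N] {f : M → N}
    (hf : Manifold.IsSmoothEmbedding I J n f) (Ψ : Diffeomorph J J N N n) :
    Manifold.IsSmoothEmbedding I J n (Ψ ∘ f) := by
  refine ⟨?_, Ψ.toHomeomorph.isEmbedding.comp hf.isEmbedding⟩
  obtain ⟨F, i1, i2, h⟩ := hf.isImmersion
  refine ⟨F, i1, i2, fun x => ?_⟩
  have hx := h x
  -- Transporting the codomain chart by `Ψ` leaves the expression of the map in charts unchanged.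
  refine Manifold.IsImmersionAtOfComplement.mk_of_charts hx.equiv hx.domChart
    (Ψ.symm.toHomeomorph.transOpenPartialHomeomorph hx.codChart) hx.mem_domChart_source ?_
    hx.domChart_mem_maximalAtlas
    (IsManifold.trans_diffeomorph_mem_maximalAtlas hx.codChart_mem_maximalAtlas _) ?_ ?_
  · simpa using hx.mem_codChart_source
  · intro y hy
    simpa using hx.source_subset_preimage_source hy
  · intro y hy
    rw [← hx.writtenInCharts hy]
    simp

/-- The inverse chart gives a left inverse of the differential; it is differentiated within `I ''
e.target`, since the model may have boundary. -/
lemma injective_mfderiv_extend [IsManifold I 1 M] {e : OpenPartialHomeomorph M H}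
    (he : e ∈ IsManifold.maximalAtlas I 1 M) {x : M} (hx : x ∈ e.source) :
    Injective (mfderiv I 𝓘(ℝ, E) (e.extend I) x) := by
  have hf : MDifferentiableAt I 𝓘(ℝ, E) (e.extend I) x :=
    (e.contMDiffAt_extend he hx).mdifferentiableAt one_ne_zero
  have hg : MDifferentiableWithinAt 𝓘(ℝ, E) I (e.extend I).symm (I '' e.target)
      (e.extend I x) :=
    (contMDiffOn_extend_symm he _ ⟨e x, e.map_source hx, rfl⟩).mdifferentiableWithinAt one_ne_zero
  have hmem : e.source ∈ 𝓝 x := e.open_source.mem_nhds hx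
  have hcomp := hg.hasMFDerivWithinAt.comp (s := e.source) x hf.hasMFDerivAt.hasMFDerivWithinAt
    fun y hy => ⟨e y, e.map_source hy, rfl⟩
  have hid : HasMFDerivAt I I (id : M → M) x
      ((mfderivWithin 𝓘(ℝ, E) I (e.extend I).symm (I '' e.target) (e.extend I x)).comp
        (mfderiv I 𝓘(ℝ, E) (e.extend I) x)) := by
    refine (hcomp.hasMFDerivAt hmem).congr_of_eventuallyEq ?_
    filter_upwards [hmem] with y hy
    exact (e.extend_left_inv hy).symm
  have heq := hasMFDerivAt_unique hid (hasMFDerivAt_id x)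
  refine LeftInverse.injective (g := mfderivWithin 𝓘(ℝ, E) I (e.extend I).symm (I '' e.target)
    (e.extend I x)) fun v => ?_
  exact congrArg (fun L => L v) heq

/-- The differential of an immersion is injective. -/
lemma Manifold.IsImmersionAt.injective_mfderiv [IsManifold I n M] [IsManifold J n N] {f : M → N}
    {x : M} (hn : 1 ≤ n) (hf : Manifold.IsImmersionAt I J n f x) :
    Injective (mfderiv I J f x) := by
  have : IsManifold I 1 M := IsManifold.of_le hn
  have : IsManifold J 1 N := IsManifold.of_le hn
  have hd := IsManifold.maximalAtlas_subset_of_le hn hf.domChart_mem_maximalAtlas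
  have hc := IsManifold.maximalAtlas_subset_of_le hn hf.codChart_mem_maximalAtlas
  have hfd : MDifferentiableAt I J f x :=
    hf.contMDiffAt.mdifferentiableAt (by rintro rfl; simp at hn)
  -- In the charts the immersion is `v ↦ (v, 0)`, so projecting back recovers the domain chart,
  -- whose differential is injective.
  let π : E' →L[ℝ] E := (ContinuousLinearMap.fst ℝ E hf.complement).comp
    (hf.equiv.symm : E' →L[ℝ] E × hf.complement)
  let g : N → E := π ∘ hf.codChart.extend J
  have hg : MDifferentiableAt J 𝓘(ℝ, E) g (f x) :=
    π.mdifferentiableAt.comp (f x)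
      ((hf.codChart.contMDiffAt_extend hc hf.mem_codChart_source).mdifferentiableAt one_ne_zero)
  have heq : g ∘ f =ᶠ[𝓝 x] hf.domChart.extend I := by
    filter_upwards [hf.domChart.open_source.mem_nhds hf.mem_domChart_source] with y hy
    have hy' : hf.domChart.extend I y ∈ (hf.domChart.extend I).target :=
      (hf.domChart.extend I).map_source (by simpa using hy)
    have := hf.writtenInCharts hy'
    simp only [comp_apply, hf.domChart.extend_left_inv hy] at this
    change (hf.equiv.symm (hf.codChart.extend J (f y))).1 = hf.domChart.extend I y
    rw [this, ContinuousLinearEquiv.symm_apply_apply]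
  have hinj := injective_mfderiv_extend hd hf.mem_domChart_source
  rw [← heq.mfderiv_eq, mfderiv_comp x hg hfd] at hinj
  exact Injective.of_comp (f := mfderiv J 𝓘(ℝ, E) g (f x)) hinj

end Immersions

/-! ### Shears of `S × ℝ` -/

section Shear

variable {S : Type*} [TopologicalSpace S] [ChartedSpace (EuclideanSpace ℝ (Fin 2)) S]

/-- The shear `(s, t) ↦ (s, g s + t)` of `S × ℝ`. -/
def shear (g : S → ℝ) (hg : ContMDiff (𝓡 2) 𝓘(ℝ, ℝ) ∞ g) :
    Diffeomorph ((𝓡 2).prod 𝓘(ℝ, ℝ)) ((𝓡 2).prod 𝓘(ℝ, ℝ)) (S × ℝ) (S × ℝ) ∞ where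
  toFun z := (z.1, g z.1 + z.2)
  invFun z := (z.1, -g z.1 + z.2)
  left_inv z := by simp
  right_inv z := by simp
  contMDiff_toFun := contMDiff_fst.prodMk ((hg.comp contMDiff_fst).add contMDiff_snd)
  contMDiff_invFun := contMDiff_fst.prodMk ((hg.comp contMDiff_fst).neg.add contMDiff_snd)

@[simp]
lemma shear_apply (g : S → ℝ) (hg : ContMDiff (𝓡 2) 𝓘(ℝ, ℝ) ∞ g) (z : S × ℝ) :
    shear g hg z = (z.1, g z.1 + z.2) := rfl

variable {H : Type*} [TopologicalSpace H] [ChartedSpace (EuclideanHalfSpace 2) H]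

/-- A shear is smoothly homotopic to the identity. -/
lemma smoothlyHomotopic_shear_comp {g : S → ℝ} (hg : ContMDiff (𝓡 2) 𝓘(ℝ, ℝ) ∞ g)
    {f : H → S × ℝ} (hf : ContMDiff (𝓡∂ 2) ((𝓡 2).prod 𝓘(ℝ, ℝ)) ∞ f) :
    SmoothlyHomotopic f (shear g hg ∘ f) := by
  have hf' : ContMDiff ((𝓡∂ 2).prod (𝓡∂ 1)) ((𝓡 2).prod 𝓘(ℝ, ℝ)) ∞
      fun z : H × unitInterval => f z.1 := hf.comp contMDiff_fst
  have ht : ContMDiff ((𝓡∂ 2).prod (𝓡∂ 1)) 𝓘(ℝ, ℝ) ∞ fun z : H × unitInterval => (z.2 : ℝ) :=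
    contMDiff_subtypeVal_Icc.comp contMDiff_snd
  have h1 := contMDiff_fst.comp hf'
  have h2 := contMDiff_snd.comp hf'
  refine ⟨fun z => ((f z.1).1, z.2 * g (f z.1).1 + (f z.1).2),
    h1.prodMk ((ht.mul (hg.comp h1)).add h2), fun x => by simp, fun x => by simp⟩

end Shear

/-! ### Patches from half-plane charts, and coordinate changes -/

section ChartPatches

open Set Filter Function

/-- The restriction of a patch along an injective linear map. -/
noncomputable def ImmersedPatch.restrict {V V' F : Type*} [NormedAddCommGroup V] [NormedSpace ℝ V]
    [NormedAddCommGroup V'] [NormedSpace ℝ V'] [NormedAddCommGroup F] [NormedSpace ℝ F]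
    (p : ImmersedPatch V F) (ι : V' →L[ℝ] V) (hι : Injective ι) : ImmersedPatch V' F where
  dom := ι ⁻¹' p.dom
  map := p.map ∘ ι
  d1 v := (p.d1 (ι v)).comp ι
  d2 v := ((ContinuousLinearMap.compL ℝ V' V F).flip ι).comp ((p.d2 (ι v)).comp ι)
  hasD1 v hv := (p.hasD1 (ι v) hv).comp v ι.hasFDerivWithinAt (mapsTo_preimage _ _)
  hasD2 v hv := (((ContinuousLinearMap.compL ℝ V' V F).flip ι).hasFDerivAt).comp_hasFDerivWithinAt v
    ((p.hasD2 (ι v) hv).comp v ι.hasFDerivWithinAt (mapsTo_preimage _ _))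
  inj v hv := (p.inj (ι v) hv).comp hι

variable {H : Type*} [TopologicalSpace H] [ChartedSpace (EuclideanHalfSpace 2) H]
  [IsManifold (𝓡∂ 2) ∞ H] {F : Type*} [NormedAddCommGroup F] [NormedSpace ℝ F]

lemma contDiffWithinAt_comp_extChartAt_symm {φ : H → F} (hφ : ContMDiff (𝓡∂ 2) 𝓘(ℝ, F) ∞ φ)
    (x : H) {v : EuclideanSpace ℝ (Fin 2)} (hv : v ∈ (extChartAt (𝓡∂ 2) x).target) :
    ContDiffWithinAt ℝ ∞ (φ ∘ (extChartAt (𝓡∂ 2) x).symm) (range (𝓡∂ 2)) v := by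
  have h := hφ.comp_contMDiffOn (contMDiffOn_extChartAt_symm (n := ∞) (I := 𝓡∂ 2) x)
  exact (contMDiffOn_iff_contDiffOn.1 h v hv).mono_of_mem_nhdsWithin
    (extChartAt_target_mem_nhdsWithin_of_mem hv)

lemma contDiffWithinAt_fderivWithin_comp_extChartAt_symm {φ : H → F}
    (hφ : ContMDiff (𝓡∂ 2) 𝓘(ℝ, F) ∞ φ)
    (x : H) {v : EuclideanSpace ℝ (Fin 2)} (hv : v ∈ (extChartAt (𝓡∂ 2) x).target) :
    ContDiffWithinAt ℝ ∞ (fderivWithin ℝ (φ ∘ (extChartAt (𝓡∂ 2) x).symm) (range (𝓡∂ 2)))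
      (range (𝓡∂ 2)) v :=
  (contDiffWithinAt_comp_extChartAt_symm hφ x hv).fderivWithin_right (𝓡∂ 2).uniqueDiffOn
    (by simp) (extChartAt_target_subset_range x hv)

lemma injective_fderivWithin_comp_extChartAt_symm {φ : H → F}
    (hφ : ContMDiff (𝓡∂ 2) 𝓘(ℝ, F) ∞ φ) (hinj : ∀ x, Injective (mfderiv (𝓡∂ 2) 𝓘(ℝ, F) φ x))
    (x : H) {v : EuclideanSpace ℝ (Fin 2)} (hv : v ∈ (extChartAt (𝓡∂ 2) x).target) :
    Injective (fderivWithin ℝ (φ ∘ (extChartAt (𝓡∂ 2) x).symm) (range (𝓡∂ 2)) v) := by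
  have : IsManifold (𝓡∂ 2) 1 H := IsManifold.of_le (n := ∞) (by simp)
  have hv' := extChartAt_target_subset_range x hv
  rw [← mfderivWithin_eq_fderivWithin, mfderiv_comp_mfderivWithin v
    (hφ.mdifferentiableAt (by simp)) (mdifferentiableWithinAt_extChartAt_symm hv)
    ((𝓡∂ 2).uniqueDiffOn v hv').uniqueMDiffWithinAt]
  exact (hinj _).comp (isInvertible_mfderivWithin_extChartAt_symm hv).injective

/-- The patch given by an immersion of a surface with boundary in a chart. -/
noncomputable def chartPatch (φ : H → F) (hφ : ContMDiff (𝓡∂ 2) 𝓘(ℝ, F) ∞ φ)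
    (hinj : ∀ x, Injective (mfderiv (𝓡∂ 2) 𝓘(ℝ, F) φ x)) (x : H) :
    ImmersedPatch (EuclideanSpace ℝ (Fin 2)) F where
  dom := (extChartAt (𝓡∂ 2) x).target
  map := φ ∘ (extChartAt (𝓡∂ 2) x).symm
  d1 := fderivWithin ℝ (φ ∘ (extChartAt (𝓡∂ 2) x).symm) (range (𝓡∂ 2))
  d2 := fderivWithin ℝ (fderivWithin ℝ (φ ∘ (extChartAt (𝓡∂ 2) x).symm) (range (𝓡∂ 2)))
    (range (𝓡∂ 2))
  hasD1 v hv := ((contDiffWithinAt_comp_extChartAt_symm hφ x hv).differentiableWithinAt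
    (by simp)).hasFDerivWithinAt.mono (extChartAt_target_subset_range x)
  hasD2 v hv := ((contDiffWithinAt_fderivWithin_comp_extChartAt_symm hφ x hv).differentiableWithinAt
    (by simp)).hasFDerivWithinAt.mono (extChartAt_target_subset_range x)
  inj v hv := injective_fderivWithin_comp_extChartAt_symm hφ hinj x hv

/-- The inclusion of the boundary line into the half plane. -/
noncomputable def boundaryLine : ℝ →L[ℝ] EuclideanSpace ℝ (Fin 2) :=
  (ContinuousLinearMap.id ℝ ℝ).smulRight (EuclideanSpace.single 1 1)

@[simp]
lemma boundaryLine_apply_zero (t : ℝ) : boundaryLine t 0 = 0 := by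
  simp [boundaryLine]

@[simp]
lemma boundaryLine_apply_one (t : ℝ) : boundaryLine t 1 = t := by
  simp [boundaryLine]

lemma boundaryLine_injective : Injective boundaryLine := fun s t h => by
  simpa using congrArg (fun v : EuclideanSpace ℝ (Fin 2) => v 1) h

lemma boundaryLine_apply_one_of_zero {v : EuclideanSpace ℝ (Fin 2)} (hv : v 0 = 0) :
    boundaryLine (v 1) = v := by
  ext i
  fin_cases i <;> simp [hv]

lemma boundaryLine_mem_range (t : ℝ) : boundaryLine t ∈ range (𝓡∂ 2) := by
  rw [range_modelWithCornersEuclideanHalfSpace]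
  simp

/-- A boundary point has vanishing zeroth coordinate in every chart. -/
lemma extChartAt_apply_zero_of_mem_boundary {x x₀ : H} (hx : x ∈ (𝓡∂ 2).boundary H)
    (hx₀ : x ∈ (chartAt (EuclideanHalfSpace 2) x₀).source) : extChartAt (𝓡∂ 2) x₀ x 0 = 0 := by
  have hx' : (𝓡∂ 2).IsBoundaryPoint x := hx
  by_contra h0
  have hmem : extChartAt (𝓡∂ 2) x₀ x ∈ (extChartAt (𝓡∂ 2) x₀).target :=
    (extChartAt (𝓡∂ 2) x₀).map_source (by simpa using hx₀)
  have hr := extChartAt_target_subset_range x₀ hmem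
  rw [range_modelWithCornersEuclideanHalfSpace] at hr
  -- A positive zeroth coordinate would make the point interior in this chart, and being a boundary
  -- point does not depend on the chart.
  have hint : extChartAt (𝓡∂ 2) x₀ x ∈ interior (range (𝓡∂ 2)) := by
    rw [interior_range_modelWithCornersEuclideanHalfSpace]
    exact lt_of_le_of_ne hr (Ne.symm h0)
  have hnhds := extChartAt_target_mem_nhdsWithin_of_mem hmem
  rw [nhdsWithin_eq_nhds.2 (mem_interior_iff_mem_nhds.1 hint)] at hnhds
  have hbd := (ModelWithCorners.isBoundaryPoint_iff_of_mem_atlas (n := ∞) (I := 𝓡∂ 2) (by simp)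
    (chart_mem_atlas _ x₀) hx₀).1 hx'
  exact hbd.2 (mem_interior_iff_mem_nhds.2 hnhds)

/-- The coordinate change from the chart at `x₁` to the chart at `x₂`. -/
noncomputable def coordChange (x₁ x₂ : H) : EuclideanSpace ℝ (Fin 2) → EuclideanSpace ℝ (Fin 2) :=
  extChartAt (𝓡∂ 2) x₂ ∘ (extChartAt (𝓡∂ 2) x₁).symm

lemma contDiffWithinAt_coordChange {x x₁ x₂ : H}
    (h₁ : x ∈ (chartAt (EuclideanHalfSpace 2) x₁).source)
    (h₂ : x ∈ (chartAt (EuclideanHalfSpace 2) x₂).source) :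
    ContDiffWithinAt ℝ ∞ (coordChange x₁ x₂) (range (𝓡∂ 2)) (extChartAt (𝓡∂ 2) x₁ x) := by
  refine contDiffWithinAt_ext_coord_change (n := ∞) x₂ x₁ ?_
  have h₁' : x ∈ (extChartAt (𝓡∂ 2) x₁).source := by simpa using h₁
  rw [PartialEquiv.trans_source]
  refine ⟨(extChartAt (𝓡∂ 2) x₁).map_source h₁', ?_⟩
  rw [mem_preimage, (extChartAt (𝓡∂ 2) x₁).left_inv h₁']
  simpa using h₂

-- Valid even off the chart target, so the chain rule applies within the whole half plane.
omit [IsManifold (𝓡∂ 2) ∞ H] in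
lemma coordChange_mem_range (x₁ x₂ : H) (v : EuclideanSpace ℝ (Fin 2)) :
    coordChange x₁ x₂ v ∈ range (𝓡∂ 2) := by
  simp [coordChange, extChartAt]

omit [IsManifold (𝓡∂ 2) ∞ H] in
lemma coordChange_apply {x x₁ : H} (x₂ : H)
    (h₁ : x ∈ (chartAt (EuclideanHalfSpace 2) x₁).source) :
    coordChange x₁ x₂ (extChartAt (𝓡∂ 2) x₁ x) = extChartAt (𝓡∂ 2) x₂ x := by
  rw [coordChange, comp_apply, (extChartAt (𝓡∂ 2) x₁).left_inv (by simpa using h₁)]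

omit [IsManifold (𝓡∂ 2) ∞ H] in
/-- Near `x` the inverse of a chart maps to a given neighbourhood of `x`. -/
lemma eventually_extChartAt_symm_mem {x x₁ : H} {s : Set H}
    (h₁ : x ∈ (chartAt (EuclideanHalfSpace 2) x₁).source) (hs : s ∈ 𝓝 x) :
    ∀ᶠ v in 𝓝[range (𝓡∂ 2)] extChartAt (𝓡∂ 2) x₁ x, v ∈ (extChartAt (𝓡∂ 2) x₁).target ∧
      (extChartAt (𝓡∂ 2) x₁).symm v ∈ s := by
  have h₁' : x ∈ (extChartAt (𝓡∂ 2) x₁).source := by simpa using h₁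
  have hc := continuousAt_extChartAt_symm' h₁'
  have h2 : ∀ᶠ v in 𝓝 (extChartAt (𝓡∂ 2) x₁ x), (extChartAt (𝓡∂ 2) x₁).symm v ∈ s := by
    refine hc ?_
    rwa [(extChartAt (𝓡∂ 2) x₁).left_inv h₁']
  exact Filter.Eventually.and (extChartAt_target_mem_nhdsWithin' h₁') (nhdsWithin_le_nhds h2)

/-- The differentials of a function read in two charts. -/
lemma fderivWithin_chart_eq {φ : H → F} (hφ : ContMDiff (𝓡∂ 2) 𝓘(ℝ, F) ∞ φ) {x x₁ x₂ : H}
    (h₁ : x ∈ (chartAt (EuclideanHalfSpace 2) x₁).source)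
    (h₂ : x ∈ (chartAt (EuclideanHalfSpace 2) x₂).source) :
    fderivWithin ℝ (φ ∘ (extChartAt (𝓡∂ 2) x₁).symm) (range (𝓡∂ 2)) (extChartAt (𝓡∂ 2) x₁ x) =
      (fderivWithin ℝ (φ ∘ (extChartAt (𝓡∂ 2) x₂).symm) (range (𝓡∂ 2))
        (extChartAt (𝓡∂ 2) x₂ x)).comp
      (fderivWithin ℝ (coordChange x₁ x₂) (range (𝓡∂ 2)) (extChartAt (𝓡∂ 2) x₁ x)) := by
  have hmem₁ : extChartAt (𝓡∂ 2) x₁ x ∈ range (𝓡∂ 2) := by simp [extChartAt]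
  have hmem₂ : extChartAt (𝓡∂ 2) x₂ x ∈ (extChartAt (𝓡∂ 2) x₂).target :=
    (extChartAt (𝓡∂ 2) x₂).map_source (by simpa using h₂)
  have hcomp : (φ ∘ (extChartAt (𝓡∂ 2) x₁).symm) =ᶠ[𝓝[range (𝓡∂ 2)] (extChartAt (𝓡∂ 2) x₁ x)]
      (φ ∘ (extChartAt (𝓡∂ 2) x₂).symm) ∘ coordChange x₁ x₂ := by
    filter_upwards [eventually_extChartAt_symm_mem h₁
      ((chartAt (EuclideanHalfSpace 2) x₂).open_source.mem_nhds h₂)] with v hv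
    simp only [comp_apply, coordChange]
    rw [(extChartAt (𝓡∂ 2) x₂).left_inv (by simpa using hv.2)]
  have hd₂ := (contDiffWithinAt_comp_extChartAt_symm hφ x₂ hmem₂).differentiableWithinAt
    (by simp : (∞ : ℕ∞ω) ≠ 0)
  rw [← coordChange_apply x₂ h₁] at hd₂ ⊢
  rw [hcomp.fderivWithin_eq_of_mem hmem₁]
  exact fderivWithin_comp _ hd₂
    ((contDiffWithinAt_coordChange h₁ h₂).differentiableWithinAt (by simp))
    (fun v _ => coordChange_mem_range x₁ x₂ v) ((𝓡∂ 2).uniqueDiffOn _ hmem₁)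

lemma fderivWithin_coordChange_comp {x x₁ x₂ : H}
    (h₁ : x ∈ (chartAt (EuclideanHalfSpace 2) x₁).source)
    (h₂ : x ∈ (chartAt (EuclideanHalfSpace 2) x₂).source) :
    (fderivWithin ℝ (coordChange x₂ x₁) (range (𝓡∂ 2)) (extChartAt (𝓡∂ 2) x₂ x)).comp
      (fderivWithin ℝ (coordChange x₁ x₂) (range (𝓡∂ 2)) (extChartAt (𝓡∂ 2) x₁ x)) =
      ContinuousLinearMap.id ℝ _ := by
  have hmem₁ : extChartAt (𝓡∂ 2) x₁ x ∈ range (𝓡∂ 2) := by simp [extChartAt]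
  have hu := (𝓡∂ 2).uniqueDiffOn _ hmem₁
  have hid : (id : EuclideanSpace ℝ (Fin 2) → _)
      =ᶠ[𝓝[range (𝓡∂ 2)] (extChartAt (𝓡∂ 2) x₁ x)] coordChange x₂ x₁ ∘ coordChange x₁ x₂ := by
    filter_upwards [eventually_extChartAt_symm_mem h₁
      ((chartAt (EuclideanHalfSpace 2) x₂).open_source.mem_nhds h₂)] with v hv
    simp only [comp_apply, coordChange, id]
    rw [(extChartAt (𝓡∂ 2) x₂).left_inv (by simpa using hv.2),
      (extChartAt (𝓡∂ 2) x₁).right_inv hv.1]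
  have hd₂ := (contDiffWithinAt_coordChange h₂ h₁).differentiableWithinAt
    (by simp : (∞ : ℕ∞ω) ≠ 0)
  rw [← coordChange_apply x₂ h₁] at hd₂ ⊢
  rw [← fderivWithin_comp _ hd₂
    ((contDiffWithinAt_coordChange h₁ h₂).differentiableWithinAt (by simp))
    (fun v _ => coordChange_mem_range x₁ x₂ v) hu, ← hid.fderivWithin_eq_of_mem hmem₁,
    fderivWithin_id hu]

/-- Coordinate changes preserve the tangent directions of the boundary. -/
lemma fderivWithin_coordChange_apply_zero {x x₁ x₂ : H} (hx : x ∈ (𝓡∂ 2).boundary H)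
    (h₁ : x ∈ (chartAt (EuclideanHalfSpace 2) x₁).source)
    (h₂ : x ∈ (chartAt (EuclideanHalfSpace 2) x₂).source) {w : EuclideanSpace ℝ (Fin 2)}
    (hw : w 0 = 0) :
    fderivWithin ℝ (coordChange x₁ x₂) (range (𝓡∂ 2)) (extChartAt (𝓡∂ 2) x₁ x) w 0 = 0 := by
  have hv0 := extChartAt_apply_zero_of_mem_boundary hx h₁
  set v := extChartAt (𝓡∂ 2) x₁ x
  have hd := ((contDiffWithinAt_coordChange h₁ h₂).differentiableWithinAt
    (by simp)).hasFDerivWithinAt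
  have hline : HasDerivAt (fun t : ℝ => v + t • w) w 0 := by
    simpa using ((hasDerivAt_id (0 : ℝ)).smul_const w).const_add v
  have hcurve : HasDerivAt (fun t : ℝ => coordChange x₁ x₂ (v + t • w))
      (fderivWithin ℝ (coordChange x₁ x₂) (range (𝓡∂ 2)) v w) 0 := by
    have hd' : HasFDerivWithinAt (coordChange x₁ x₂)
        (fderivWithin ℝ (coordChange x₁ x₂) (range (𝓡∂ 2)) v) (range (𝓡∂ 2))
        (v + (0 : ℝ) • w) := by
      rw [zero_smul, add_zero]
      exact hd
    rw [← hasDerivWithinAt_univ] at hline ⊢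
    refine hd'.comp_hasDerivWithinAt (0 : ℝ) hline fun t _ => ?_
    rw [range_modelWithCornersEuclideanHalfSpace]
    simp [hv0, hw]
  have hcoord := (EuclideanSpace.proj (0 : Fin 2) :
    EuclideanSpace ℝ (Fin 2) →L[ℝ] ℝ).hasFDerivAt.comp_hasDerivAt (0 : ℝ) hcurve
  -- Along the boundary line the zeroth coordinate of the image is nonnegative and vanishes at `t =
  -- 0`, so it has a minimum there.
  refine IsLocalMin.hasDerivAt_eq_zero (Eventually.of_forall fun t => ?_) hcoord
  have h0 : coordChange x₁ x₂ (v + (0 : ℝ) • w) 0 = 0 := by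
    rw [zero_smul, add_zero, coordChange_apply x₂ h₁]
    exact extChartAt_apply_zero_of_mem_boundary hx h₂
  have ht := coordChange_mem_range x₁ x₂ (v + t • w)
  rw [range_modelWithCornersEuclideanHalfSpace] at ht
  change coordChange x₁ x₂ (v + (0 : ℝ) • w) 0 ≤ coordChange x₁ x₂ (v + t • w) 0
  rw [h0]
  exact ht

end ChartPatches

/-! ### From patches to `IsMorse` -/

section Transfer

open Set Filter Function

variable {H : Type*} [TopologicalSpace H] [ChartedSpace (EuclideanHalfSpace 2) H]
  [IsManifold (𝓡∂ 2) ∞ H]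

/-- At a point with vanishing differential, nondegeneracy of the Hessian can be checked in any
chart. -/
lemma hessAt_nondegenerate_of_chart {φ : H → ℝ} (hφ : ContMDiff (𝓡∂ 2) 𝓘(ℝ, ℝ) ∞ φ) {x x₀ : H}
    (h₀ : x ∈ (chartAt (EuclideanHalfSpace 2) x₀).source) (hd : diffAt φ x = 0)
    (hn : ∀ w, fderivWithin ℝ (fderivWithin ℝ (inChart φ x₀) (range (𝓡∂ 2))) (range (𝓡∂ 2))
      (extChartAt (𝓡∂ 2) x₀ x) w = 0 → w = 0)
    (v : EuclideanSpace ℝ (Fin 2)) (hv : ∀ w, hessAt φ x v w = 0) : v = 0 := by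
  have hx := mem_chart_source (EuclideanHalfSpace 2) x
  have hmem : extChartAt (𝓡∂ 2) x x ∈ range (𝓡∂ 2) := by simp [extChartAt]
  have hmem₀ : extChartAt (𝓡∂ 2) x₀ x ∈ (extChartAt (𝓡∂ 2) x₀).target :=
    (extChartAt (𝓡∂ 2) x₀).map_source (by simpa using h₀)
  have hu := (𝓡∂ 2).uniqueDiffOn _ hmem
  have hT := contDiffWithinAt_coordChange hx h₀
  have hTu := coordChange_apply x₀ hx
  set u := extChartAt (𝓡∂ 2) x x
  set T := coordChange x x₀
  set Q := range (𝓡∂ 2)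
  -- This removes the term with the second derivative of `T`, so the Hessian changes as a bilinear
  -- form.
  have hA0 : fderivWithin ℝ (inChart φ x₀) Q (T u) = 0 := by
    rw [hTu]
    refine (fderivWithin_chart_eq hφ h₀ hx).trans ?_
    change (diffAt φ x).comp _ = 0
    rw [hd, ContinuousLinearMap.zero_comp]
  have heq : fderivWithin ℝ (inChart φ x) Q =ᶠ[𝓝[Q] u]
      fun v => (fderivWithin ℝ (inChart φ x₀) Q (T v)).comp (fderivWithin ℝ T Q v) := by
    filter_upwards [eventually_extChartAt_symm_mem hx (inter_mem
      ((chartAt (EuclideanHalfSpace 2) x).open_source.mem_nhds hx)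
      ((chartAt (EuclideanHalfSpace 2) x₀).open_source.mem_nhds h₀))] with v hv
    have h := fderivWithin_chart_eq hφ hv.2.1 hv.2.2
    rw [← coordChange_apply x₀ hv.2.1, (extChartAt (𝓡∂ 2) x).right_inv hv.1] at h
    exact h
  have hDT : HasFDerivWithinAt T (fderivWithin ℝ T Q u) Q u :=
    (hT.differentiableWithinAt (by simp)).hasFDerivWithinAt
  have hD2T : HasFDerivWithinAt (fderivWithin ℝ T Q) (fderivWithin ℝ (fderivWithin ℝ T Q) Q u) Q u :=
    ((hT.fderivWithin_right (m := ∞) (𝓡∂ 2).uniqueDiffOn (by simp) hmem).differentiableWithinAt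
      (by simp)).hasFDerivWithinAt
  have hA : HasFDerivWithinAt (fderivWithin ℝ (inChart φ x₀) Q)
      (fderivWithin ℝ (fderivWithin ℝ (inChart φ x₀) Q) Q (T u)) Q (T u) := by
    rw [hTu]
    exact ((contDiffWithinAt_fderivWithin_comp_extChartAt_symm hφ x₀ hmem₀).differentiableWithinAt
      (by simp)).hasFDerivWithinAt
  have hAT := hA.comp u hDT fun v _ => coordChange_mem_range x x₀ v
  have hhess : ∀ v w, hessAt φ x v w =
      fderivWithin ℝ (fderivWithin ℝ (inChart φ x₀) Q) Q (T u) (fderivWithin ℝ T Q u v)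
        (fderivWithin ℝ T Q u w) := by
    intro v w
    have h := (hAT.clm_comp hD2T).fderivWithin hu
    have h' : hessAt φ x = _ := (heq.fderivWithin_eq_of_mem hmem).trans h
    rw [h']
    simp [hA0]
  have hleft : ∀ w, fderivWithin ℝ (coordChange x₀ x) Q (extChartAt (𝓡∂ 2) x₀ x)
      (fderivWithin ℝ T Q u w) = w := fun w =>
    congrArg (fun L => L w) (fderivWithin_coordChange_comp hx h₀)
  have hright : ∀ w, fderivWithin ℝ T Q u
      (fderivWithin ℝ (coordChange x₀ x) Q (extChartAt (𝓡∂ 2) x₀ x) w) = w := fun w =>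
    congrArg (fun L => L w) (fderivWithin_coordChange_comp h₀ hx)
  rw [← hTu] at hn
  have h0 : fderivWithin ℝ T Q u v = 0 := hn _ <| by
    ext w
    rw [← hright w, ← hhess]
    simpa using hv _
  rw [← hleft v, h0, map_zero]

variable {E : Type*} [NormedAddCommGroup E] [NormedSpace ℝ E] {G : H → E × ℝ}
  (hG : ContMDiff (𝓡∂ 2) 𝓘(ℝ, E × ℝ) ∞ G)
  (hinj : ∀ x, Injective (mfderiv (𝓡∂ 2) 𝓘(ℝ, E × ℝ) G x)) (a : E →L[ℝ] ℝ)

omit [IsManifold (𝓡∂ 2) ∞ H] in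
include hG in
lemma contMDiff_affineHeight_comp :
    ContMDiff (𝓡∂ 2) 𝓘(ℝ, ℝ) ∞ (fun x => affineHeight a (G x)) :=
  (affineHeight a).contMDiff.comp hG

include hG in
lemma fderivWithin_inChart_affineHeight (x₀ : H) {v : EuclideanSpace ℝ (Fin 2)}
    (hv : v ∈ (extChartAt (𝓡∂ 2) x₀).target) :
    fderivWithin ℝ (inChart (fun x => affineHeight a (G x)) x₀) (range (𝓡∂ 2)) v =
      (affineHeight a).comp
        (fderivWithin ℝ (G ∘ (extChartAt (𝓡∂ 2) x₀).symm) (range (𝓡∂ 2)) v) :=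
  ((affineHeight a).hasFDerivAt.comp_hasFDerivWithinAt v
    ((contDiffWithinAt_comp_extChartAt_symm hG x₀ hv).differentiableWithinAt
      (by simp)).hasFDerivWithinAt).fderivWithin
    ((𝓡∂ 2).uniqueDiffOn v (extChartAt_target_subset_range x₀ hv))

lemma fderivWithin_fderivWithin_inChart_affineHeight (x₀ : H) {v : EuclideanSpace ℝ (Fin 2)}
    (hv : v ∈ (extChartAt (𝓡∂ 2) x₀).target) :
    fderivWithin ℝ (fderivWithin ℝ (inChart (fun x => affineHeight a (G x)) x₀) (range (𝓡∂ 2)))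
      (range (𝓡∂ 2)) v = (chartPatch G hG hinj x₀).hess a v := by
  have hv' := extChartAt_target_subset_range x₀ hv
  have heq : fderivWithin ℝ (inChart (fun x => affineHeight a (G x)) x₀) (range (𝓡∂ 2))
      =ᶠ[𝓝[range (𝓡∂ 2)] v] fun v => (affineHeight a).comp
        (fderivWithin ℝ (G ∘ (extChartAt (𝓡∂ 2) x₀).symm) (range (𝓡∂ 2)) v) := by
    filter_upwards [extChartAt_target_mem_nhdsWithin_of_mem hv] with w hw
    exact fderivWithin_inChart_affineHeight hG a x₀ hw
  rw [heq.fderivWithin_eq_of_mem hv']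
  exact ((ContinuousLinearMap.compL ℝ (EuclideanSpace ℝ (Fin 2)) (E × ℝ) ℝ
    (affineHeight a)).hasFDerivAt.comp_hasFDerivWithinAt v
    ((contDiffWithinAt_fderivWithin_comp_extChartAt_symm hG x₀ hv).differentiableWithinAt
      (by simp)).hasFDerivWithinAt).fderivWithin ((𝓡∂ 2).uniqueDiffOn v hv')

lemma chartPatch_isCrit {x x₀ : H} (h₀ : x ∈ (chartAt (EuclideanHalfSpace 2) x₀).source)
    (hd : diffAt (fun x => affineHeight a (G x)) x = 0) :
    (chartPatch G hG hinj x₀).IsCrit a (extChartAt (𝓡∂ 2) x₀ x) := by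
  have hmem₀ : extChartAt (𝓡∂ 2) x₀ x ∈ (extChartAt (𝓡∂ 2) x₀).target :=
    (extChartAt (𝓡∂ 2) x₀).map_source (by simpa using h₀)
  refine ⟨hmem₀, ?_⟩
  refine (fderivWithin_inChart_affineHeight hG a x₀ hmem₀).symm.trans ?_
  refine (fderivWithin_chart_eq (contMDiff_affineHeight_comp hG a) h₀
    (mem_chart_source (EuclideanHalfSpace 2) x)).trans ?_
  change (diffAt _ x).comp _ = 0
  rw [hd, ContinuousLinearMap.zero_comp]

lemma chartPatch_map {x x₀ : H} (h₀ : x ∈ (chartAt (EuclideanHalfSpace 2) x₀).source) :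
    (chartPatch G hG hinj x₀).map (extChartAt (𝓡∂ 2) x₀ x) = G x := by
  change G ((extChartAt (𝓡∂ 2) x₀).symm (extChartAt (𝓡∂ 2) x₀ x)) = G x
  rw [(extChartAt (𝓡∂ 2) x₀).left_inv (by simpa using h₀)]

/-- The patch given by the restriction of an immersion to the boundary, in a chart. -/
noncomputable def boundaryPatch (x₀ : H) : ImmersedPatch ℝ (E × ℝ) :=
  (chartPatch G hG hinj x₀).restrict boundaryLine boundaryLine_injective

lemma boundaryPatch_map {x x₀ : H} (hx : x ∈ (𝓡∂ 2).boundary H)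
    (h₀ : x ∈ (chartAt (EuclideanHalfSpace 2) x₀).source) :
    (boundaryPatch hG hinj x₀).map (extChartAt (𝓡∂ 2) x₀ x 1) = G x := by
  rw [← chartPatch_map hG hinj h₀,
    ← boundaryLine_apply_one_of_zero (extChartAt_apply_zero_of_mem_boundary hx h₀)]
  simp [boundaryPatch, ImmersedPatch.restrict]

lemma boundaryPatch_isCrit {x x₀ : H} (h₀ : x ∈ (chartAt (EuclideanHalfSpace 2) x₀).source)
    (hx : IsBoundaryCritical (fun x => affineHeight a (G x)) x) :
    (boundaryPatch hG hinj x₀).IsCrit a (extChartAt (𝓡∂ 2) x₀ x 1) := by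
  have hline := boundaryLine_apply_one_of_zero (extChartAt_apply_zero_of_mem_boundary hx.1 h₀)
  have hmem₀ : extChartAt (𝓡∂ 2) x₀ x ∈ (extChartAt (𝓡∂ 2) x₀).target :=
    (extChartAt (𝓡∂ 2) x₀).map_source (by simpa using h₀)
  have hx₁ := mem_chart_source (EuclideanHalfSpace 2) x
  refine ⟨show boundaryLine _ ∈ (extChartAt (𝓡∂ 2) x₀).target by rwa [hline], ?_⟩
  ext
  change affineHeight a (fderivWithin ℝ (G ∘ (extChartAt (𝓡∂ 2) x₀).symm) (range (𝓡∂ 2))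
    (boundaryLine _) (boundaryLine 1)) = 0
  rw [hline]
  have h1 := congrArg (fun L => L (boundaryLine 1))
    (fderivWithin_inChart_affineHeight hG a x₀ hmem₀)
  have h2 := congrArg (fun L => L (boundaryLine 1)) (fderivWithin_chart_eq
    (contMDiff_affineHeight_comp hG a) h₀ hx₁)
  refine h1.symm.trans (h2.trans ?_)
  exact hx.2 _ (fderivWithin_coordChange_apply_zero hx.1 h₀ hx₁ (by simp))

/-- The whole boundary line lies in the half plane, so only the open chart target constrains `t`.
Hence derivatives within the domain are ordinary derivatives, and the second derivative test
applies. -/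
lemma isOpen_boundaryPatch_dom (x₀ : H) : IsOpen (boundaryPatch hG hinj x₀).dom := by
  have h : (boundaryPatch hG hinj x₀).dom =
      (fun t => (𝓡∂ 2).symm (boundaryLine t)) ⁻¹' (chartAt (EuclideanHalfSpace 2) x₀).target := by
    ext t
    change boundaryLine t ∈ (extChartAt (𝓡∂ 2) x₀).target ↔ _
    rw [extChartAt_target]
    exact and_iff_left (boundaryLine_mem_range t)
  rw [h]
  exact (chartAt (EuclideanHalfSpace 2) x₀).open_target.preimage
    ((𝓡∂ 2).continuous_symm.comp boundaryLine.continuous)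

variable {a}

/-- A nondegenerate critical point of the restriction to the boundary is an isolated local
extremum. -/
lemma boundary_extremum_and_isolated {x x₀ : H}
    (h₀ : x ∈ (chartAt (EuclideanHalfSpace 2) x₀).source)
    (hx : IsBoundaryCritical (fun x => affineHeight a (G x)) x)
    (hn : ∀ w, (boundaryPatch hG hinj x₀).hess a (extChartAt (𝓡∂ 2) x₀ x 1) w = 0 → w = 0) :
    IsLocalExtrOn (fun x => affineHeight a (G x)) ((𝓡∂ 2).boundary H) x ∧
      ∀ᶠ y in 𝓝[≠] x, ¬ IsBoundaryCritical (fun x => affineHeight a (G x)) y := by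
  have hcrit := boundaryPatch_isCrit hG hinj a h₀ hx
  have hmap := fun y hy h => boundaryPatch_map (x := y) hG hinj hy h (x₀ := x₀)
  have hcritmap := fun y h => boundaryPatch_isCrit (x := y) hG hinj a h (x₀ := x₀)
  have hopen := isOpen_boundaryPatch_dom hG hinj x₀
  set p := boundaryPatch hG hinj x₀
  let ψ : H → ℝ := fun y => extChartAt (𝓡∂ 2) x₀ y 1
  have hψ : ContinuousAt ψ x :=
    (EuclideanSpace.proj (1 : Fin 2) : EuclideanSpace ℝ (Fin 2) →L[ℝ] ℝ).continuous.continuousAt.comp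
      (continuousAt_extChartAt' (by simpa using h₀))
  have hsource : ∀ᶠ y in 𝓝 x, y ∈ (chartAt (EuclideanHalfSpace 2) x₀).source :=
    (chartAt (EuclideanHalfSpace 2) x₀).open_source.mem_nhds h₀
  let q : ℝ → ℝ := fun t => affineHeight a (p.map t)
  let q' : ℝ → ℝ := fun t => affineHeight a (p.d1 t 1)
  have hq : ∀ t ∈ p.dom, HasDerivAt q (q' t) t := fun t ht =>
    ((affineHeight a).hasFDerivAt.comp t ((p.hasD1 t ht).hasFDerivAt
      (hopen.mem_nhds ht))).hasDerivAt
  have hq' : HasDerivAt q' (p.hess a (ψ x) 1 1) (ψ x) := by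
    have h1 := ((p.hasD2 _ hcrit.1).hasFDerivAt (hopen.mem_nhds hcrit.1)).clm_apply
      (hasFDerivAt_const (1 : ℝ) (ψ x))
    have h2 := ((affineHeight a).hasFDerivAt.comp (ψ x) h1).hasDerivAt
    refine h2.congr_deriv ?_
    simp [ψ]
  have hne : p.hess a (ψ x) 1 1 ≠ 0 := fun h =>
    one_ne_zero (hn 1 (by ext; exact h))
  have hzero : ∀ t, p.IsCrit a t → q' t = 0 := fun t ht =>
    congrArg (fun L => L 1) ht.2
  have hderiv : deriv q =ᶠ[𝓝 (ψ x)] q' := by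
    filter_upwards [hopen.mem_nhds hcrit.1] with t ht using (hq t ht).deriv
  have hd1 : deriv q (ψ x) = 0 := hderiv.eq_of_nhds.trans (hzero _ hcrit)
  have hd2 : deriv (deriv q) (ψ x) = p.hess a (ψ x) 1 1 := hderiv.deriv_eq.trans hq'.deriv
  have hcont : ContinuousAt q (ψ x) := (hq _ hcrit.1).continuousAt
  have hval : ∀ᶠ y in 𝓝[(𝓡∂ 2).boundary H] x, affineHeight a (G y) = q (ψ y) := by
    filter_upwards [nhdsWithin_le_nhds hsource, self_mem_nhdsWithin] with y hy hb
    rw [← hmap y hb hy]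
  have hvalx : affineHeight a (G x) = q (ψ x) := hval.self_of_nhdsWithin hx.1
  constructor
  · rcases hne.lt_or_gt with h | h
    · have hmax := isLocalMax_of_deriv_deriv_neg (hd2 ▸ h) hd1 hcont
      refine Or.inr ?_
      filter_upwards [hval, nhdsWithin_le_nhds (hψ.eventually hmax)] with y h1 h2
      rw [h1, hvalx]
      exact h2
    · have hmin := isLocalMin_of_deriv_deriv_pos (hd2 ▸ h) hd1 hcont
      refine Or.inl ?_
      filter_upwards [hval, nhdsWithin_le_nhds (hψ.eventually hmin)] with y h1 h2
      rw [h1, hvalx]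
      exact h2
  -- A zero of `q'` with nonzero derivative is isolated; boundary points of the chart are determined
  -- by their coordinate `ψ`.
  · have hiso : ∀ᶠ t in 𝓝 (ψ x), t ≠ ψ x → q' t ≠ 0 :=
      eventually_nhdsWithin_iff.1 (hq'.eventually_ne hne)
    filter_upwards [nhdsWithin_le_nhds hsource, nhdsWithin_le_nhds (hψ.eventually hiso),
      self_mem_nhdsWithin] with y hy hyq hyx hyc
    have heq : ψ y = ψ x := by
      by_contra h
      exact hyq h (hzero _ (hcritmap y hy hyc))
    refine hyx ((extChartAt (𝓡∂ 2) x₀).injOn (by simpa using hy) (by simpa using h₀) ?_)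
    rw [← boundaryLine_apply_one_of_zero (extChartAt_apply_zero_of_mem_boundary hyc.1 hy),
      ← boundaryLine_apply_one_of_zero (extChartAt_apply_zero_of_mem_boundary hx.1 h₀)]
    exact congrArg boundaryLine heq

end Transfer

/-! ### Choice of a generic functional -/

section Genericity

open Set Filter Function MeasureTheory

variable {H : Type*} [TopologicalSpace H] [CompactSpace H] [ChartedSpace (EuclideanHalfSpace 2) H]
  [IsManifold (𝓡∂ 2) ∞ H] {E : Type*} [NormedAddCommGroup E] [NormedSpace ℝ E]
  [FiniteDimensional ℝ E] {G : H → E × ℝ}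

/-- A generic functional of the form `(y, t) ↦ a y + t` restricts to a Morse function on an
immersed compact surface, and critical points with distinct first components have distinct
values. -/
lemma exists_isMorse_affineHeight (hG : ContMDiff (𝓡∂ 2) 𝓘(ℝ, E × ℝ) ∞ G)
    (hinj : ∀ x, Injective (mfderiv (𝓡∂ 2) 𝓘(ℝ, E × ℝ) G x)) :
    ∃ a : E →L[ℝ] ℝ, IsMorse (fun x => affineHeight a (G x)) ∧
      ∀ x y, IsCritical (fun x => affineHeight a (G x)) x →
        IsCritical (fun x => affineHeight a (G x)) y → (G x).1 ≠ (G y).1 →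
        affineHeight a (G x) ≠ affineHeight a (G y) := by
  -- Finitely many charts suffice, so the almost-everywhere conditions on `a` can be met
  -- simultaneously, including those comparing different charts and interior with boundary.
  obtain ⟨t, ht⟩ := CompactSpace.elim_nhds_subcover
    (fun x : H => (chartAt (EuclideanHalfSpace 2) x).source)
    fun x => (chartAt (EuclideanHalfSpace 2) x).open_source.mem_nhds (mem_chart_source _ x)
  have hcover : ∀ x : H, ∃ x₀ ∈ t, x ∈ (chartAt (EuclideanHalfSpace 2) x₀).source := fun x => by
    simpa using ht.ge (mem_univ x)
  let c := chartPatch G hG hinj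
  let b := boundaryPatch hG hinj
  have htc : (t : Set H).Countable := t.countable_toSet
  let μ : Measure (E →L[ℝ] ℝ) := Measure.addHaar
  have hc := (ae_ball_iff htc).2 fun x₀ _ => (c x₀).ae_injective_hess μ
  have hb := (ae_ball_iff htc).2 fun x₀ _ => (b x₀).ae_injective_hess μ
  have hcc := (ae_ball_iff htc).2 fun x₀ _ => (ae_ball_iff htc).2 fun y₀ _ =>
    (c x₀).ae_critical_values_ne μ (c y₀)
  have hcb := (ae_ball_iff htc).2 fun x₀ _ => (ae_ball_iff htc).2 fun y₀ _ =>
    (c x₀).ae_critical_values_ne μ (b y₀)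
  have hbb := (ae_ball_iff htc).2 fun x₀ _ => (ae_ball_iff htc).2 fun y₀ _ =>
    (b x₀).ae_critical_values_ne μ (b y₀)
  obtain ⟨a, hc, hb, hcc, hcb, hbb⟩ := (hc.and (hb.and (hcc.and (hcb.and hbb)))).exists
  have hsmooth := contMDiff_affineHeight_comp hG a
  refine ⟨a, ⟨hsmooth, fun x hd => ?_, fun x hx => ?_, fun x hx => ?_⟩, fun x y hx hy hne => ?_⟩
  · obtain ⟨x₀, hx₀, h₀⟩ := hcover x
    refine hessAt_nondegenerate_of_chart hsmooth h₀ hd fun w hw => ?_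
    rw [fderivWithin_fderivWithin_inChart_affineHeight hG hinj a x₀
      ((extChartAt (𝓡∂ 2) x₀).map_source (by simpa using h₀))] at hw
    exact hc x₀ hx₀ _ (chartPatch_isCrit hG hinj a h₀ hd) w hw
  · obtain ⟨x₀, hx₀, h₀⟩ := hcover x
    exact (boundary_extremum_and_isolated hG hinj h₀ hx
      (hb x₀ hx₀ _ (boundaryPatch_isCrit hG hinj a h₀ hx))).1
  · obtain ⟨x₀, hx₀, h₀⟩ := hcover x
    exact (boundary_extremum_and_isolated hG hinj h₀ hx
      (hb x₀ hx₀ _ (boundaryPatch_isCrit hG hinj a h₀ hx))).2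
  · obtain ⟨x₀, hx₀, h₀⟩ := hcover x
    obtain ⟨y₀, hy₀, h₁⟩ := hcover y
    have hxm := chartPatch_map hG hinj h₀
    have hym := chartPatch_map hG hinj h₁
    rcases hx with hx | hx <;> rcases hy with hy | hy
    · have h := hcc x₀ hx₀ y₀ hy₀ _ _ (chartPatch_isCrit hG hinj a h₀ hx)
        (chartPatch_isCrit hG hinj a h₁ hy)
      rw [hxm, hym] at h
      exact h hne
    · have h := hcb x₀ hx₀ y₀ hy₀ _ _ (chartPatch_isCrit hG hinj a h₀ hx)
        (boundaryPatch_isCrit hG hinj a h₁ hy)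
      rw [hxm, boundaryPatch_map hG hinj hy.1 h₁] at h
      exact h hne
    · have h := hcb y₀ hy₀ x₀ hx₀ _ _ (chartPatch_isCrit hG hinj a h₁ hy)
        (boundaryPatch_isCrit hG hinj a h₀ hx)
      rw [hym, boundaryPatch_map hG hinj hx.1 h₀] at h
      exact (h hne.symm).symm
    · have h := hbb x₀ hx₀ y₀ hy₀ _ _ (boundaryPatch_isCrit hG hinj a h₀ hx)
        (boundaryPatch_isCrit hG hinj a h₁ hy)
      rw [boundaryPatch_map hG hinj hx.1 h₀, boundaryPatch_map hG hinj hy.1 h₁] at h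
      exact h hne

end Genericity

/-! ### Immersions into `E × ℝ` -/

section Products

open Function

variable {S : Type*} [TopologicalSpace S] [ChartedSpace (EuclideanSpace ℝ (Fin 2)) S]
  {H : Type*} [TopologicalSpace H] [ChartedSpace (EuclideanHalfSpace 2) H]
  {E : Type*} [NormedAddCommGroup E] [NormedSpace ℝ E]

/-- Composing an injectively differentiable map to `S × ℝ` with an injectively differentiable map
of the first factor gives an injectively differentiable map. -/
lemma injective_mfderiv_prodMap_id_comp {f : H → S × ℝ} {e : S → E}
    (hf : ContMDiff (𝓡∂ 2) ((𝓡 2).prod 𝓘(ℝ, ℝ)) ∞ f) (he : ContMDiff (𝓡 2) 𝓘(ℝ, E) ∞ e)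
    (hfinj : ∀ x, Injective (mfderiv (𝓡∂ 2) ((𝓡 2).prod 𝓘(ℝ, ℝ)) f x))
    (heinj : ∀ s, Injective (mfderiv (𝓡 2) 𝓘(ℝ, E) e s)) (x : H) :
    Injective (mfderiv (𝓡∂ 2) 𝓘(ℝ, E × ℝ) (fun x => (e (f x).1, (f x).2)) x) := by
  have hp : ContMDiff (𝓡∂ 2) (𝓡 2) ∞ (fun x => (f x).1) := contMDiff_fst.comp hf
  have hh : ContMDiff (𝓡∂ 2) 𝓘(ℝ, ℝ) ∞ (fun x => (f x).2) := contMDiff_snd.comp hf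
  have hG : ContMDiff (𝓡∂ 2) 𝓘(ℝ, E × ℝ) ∞ (fun x => (e (f x).1, (f x).2)) :=
    (he.comp hp).prodMk_space hh
  have hfm := hf.mdifferentiableAt (x := x) (by simp)
  have hpm := hp.mdifferentiableAt (x := x) (by simp)
  have hhm := hh.mdifferentiableAt (x := x) (by simp)
  have hem := he.mdifferentiableAt (x := (f x).1) (by simp)
  have hGm := hG.mdifferentiableAt (x := x) (by simp)
  have h1 : mfderiv (𝓡∂ 2) 𝓘(ℝ, E) (fun x => e (f x).1) x =
      (ContinuousLinearMap.fst ℝ E ℝ).comp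
        (mfderiv (𝓡∂ 2) 𝓘(ℝ, E × ℝ) (fun x => (e (f x).1, (f x).2)) x) :=
    ((ContinuousLinearMap.fst ℝ E ℝ).hasMFDerivAt.comp x hGm.hasMFDerivAt).mfderiv
  have h2 : mfderiv (𝓡∂ 2) 𝓘(ℝ, ℝ) (fun x => (f x).2) x =
      (ContinuousLinearMap.snd ℝ E ℝ).comp
        (mfderiv (𝓡∂ 2) 𝓘(ℝ, E × ℝ) (fun x => (e (f x).1, (f x).2)) x) :=
    ((ContinuousLinearMap.snd ℝ E ℝ).hasMFDerivAt.comp x hGm.hasMFDerivAt).mfderiv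
  have h3 : mfderiv (𝓡∂ 2) 𝓘(ℝ, E) (fun x => e (f x).1) x =
      (mfderiv (𝓡 2) 𝓘(ℝ, E) e (f x).1).comp (mfderiv (𝓡∂ 2) (𝓡 2) (fun x => (f x).1) x) :=
    mfderiv_comp x hem hpm
  have h4 : mfderiv (𝓡∂ 2) ((𝓡 2).prod 𝓘(ℝ, ℝ)) f x =
      (mfderiv (𝓡∂ 2) (𝓡 2) (fun x => (f x).1) x).prod
        (mfderiv (𝓡∂ 2) 𝓘(ℝ, ℝ) (fun x => (f x).2) x) :=
    mfderiv_prodMk hpm hhm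
  rw [injective_iff_map_eq_zero]
  intro v hv
  have hv2 : mfderiv (𝓡∂ 2) 𝓘(ℝ, ℝ) (fun x => (f x).2) x v = 0 := by
    rw [h2]
    exact congrArg Prod.snd hv
  have hv1 : mfderiv (𝓡∂ 2) (𝓡 2) (fun x => (f x).1) x v = 0 := by
    refine (injective_iff_map_eq_zero _).1 (heinj (f x).1) _ ?_
    have h5 : mfderiv (𝓡∂ 2) 𝓘(ℝ, E) (fun x => e (f x).1) x v = 0 := by
      rw [h1]
      exact congrArg Prod.fst hv
    rw [h3] at h5
    exact h5
  refine (injective_iff_map_eq_zero _).1 (hfinj x) v ?_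
  rw [h4]
  exact Prod.ext hv1 hv2

end Products

/-! ### The theorem -/

theorem mainTheorem4
    {S : Type*} [TopologicalSpace S] [T2Space S] [CompactSpace S]
    [ChartedSpace (EuclideanSpace ℝ (Fin 2)) S] [IsManifold (𝓡 2) ∞ S]
    {H : Type*} [TopologicalSpace H] [CompactSpace H]
    [ChartedSpace (EuclideanHalfSpace 2) H] [IsManifold (𝓡∂ 2) ∞ H]
    (f : H → S × ℝ)
    (hf : Manifold.IsSmoothEmbedding (𝓡∂ 2) ((𝓡 2).prod 𝓘(ℝ, ℝ)) ∞ f)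
    (m₁ m₂ : Set (S × ℝ)) (hm₁ : IsMulticurve m₁) (hm₂ : IsMulticurve m₂)
    (hdisj : Disjoint m₁ m₂)
    (hboundary : f '' (𝓡∂ 2).boundary H = m₁ ∪ m₂) :
    ∃ f' : H → S × ℝ,
      Manifold.IsSmoothEmbedding (𝓡∂ 2) ((𝓡 2).prod 𝓘(ℝ, ℝ)) ∞ f' ∧
      SmoothlyHomotopic f f' ∧
      IsMorse (fun x => (f' x).2) ∧
      ∀ x y : H, IsCritical (fun x => (f' x).2) x → IsCritical (fun x => (f' x).2) y →
        (f' x).2 = (f' y).2 → x = y := by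

  have hfs := hf.contMDiff
  have hfinj : ∀ x, Function.Injective (mfderiv (𝓡∂ 2) ((𝓡 2).prod 𝓘(ℝ, ℝ)) f x) := fun x =>
    (hf.isImmersion.isImmersionAt x).injective_mfderiv (by simp)
  obtain ⟨n, e, he, hemb, heinj⟩ := exists_embedding_euclidean_of_compact (I := 𝓡 2) (M := S)
  let G : H → EuclideanSpace ℝ (Fin n) × ℝ := fun x => (e (f x).1, (f x).2)
  have hG : ContMDiff (𝓡∂ 2) 𝓘(ℝ, EuclideanSpace ℝ (Fin n) × ℝ) ∞ G :=
    (he.comp (contMDiff_fst.comp hfs)).prodMk_space (contMDiff_snd.comp hfs)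
  obtain ⟨a, hmorse, hdist⟩ := exists_isMorse_affineHeight hG
    (injective_mfderiv_prodMap_id_comp hfs he hfinj heinj)
  have hg : ContMDiff (𝓡 2) 𝓘(ℝ, ℝ) ∞ (fun s => a (e s)) := a.contMDiff.comp he
  have hheight : (fun x => ((shear _ hg ∘ f) x).2) = fun x => affineHeight a (G x) := by
    ext x
    simp [G]
  refine ⟨shear _ hg ∘ f, hf.diffeomorph_comp _, smoothlyHomotopic_shear_comp hg hfs, ?_, ?_⟩
  · rw [hheight]
    exact hmorse
  · rw [hheight]
    intro x y hx hy hxy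
    have hxy' : affineHeight a (G x) = affineHeight a (G y) := by
      rwa [← congrFun hheight x, ← congrFun hheight y]
    -- Points over the same point of `S` may escape genericity, but the shear raises both equally,
    -- so equal heights afterwards mean equal heights before.
    have h1 : (G x).1 = (G y).1 := by
      by_contra hne
      exact hdist x y hx hy hne hxy'
    have h2 : (f x).2 = (f y).2 := by
      rw [affineHeight_apply, affineHeight_apply, h1] at hxy'
      exact add_left_cancel hxy'
    exact hf.isEmbedding.injective (Prod.ext (hemb.injective h1) h2)
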